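/- A polymatrix game consists of players $1,\dots,n$, a finite set of $m_k$ pure strategies for each player $k$, and for each ordered pair $k\neq l$ a payoff matrix $P_{kl}\in\mathbb{Q}^{m_k\times m_l}$. The payoff of player $k$ at a joint action $a=(a_1,\dots,a_n)$ is $u_k(a)=\sum_{l\neq k}P_{kl}[a_k,a_l]$, and $u_k$ is extended multilinearly to joint mixed strategies $x=(x_1,\dots,x_n)\in\prod_k\Delta^{m_k-1}$ by taking expectations. As usual, utilities are normalized: $0\le u_k(a)\le 1$ for all $k$ and $a$. A joint mixed strategy $x$ is an $\varepsilon$-Nash equilibrium if $u_k(z_k,x_{-k})\le u_k(x)+\varepsilon$ for every player $k$ and every $z_k\in\Delta^{m_k-1}$, and a Nash equilibrium if this holds with $\varepsilon=0$; a Nash equilibrium is interior if every pure strategy of every player has positive probability in it. The class of polymatrix games that have an interior Nash equilibrium admits a fully polynomial-time deterministic approximation scheme (FPTAS) for Nash equilibria. That is, there are a single deterministic algorithm (a random access machine program on integers, charged logarithmic, i.e. bit, cost) and a polynomial $p$ such that, for every normalized polymatrix game $G$ with an interior Nash equilibrium and every rational $\varepsilon>0$, the algorithm on input $(G,\varepsilon)$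 halts within time $p(s+\lceil 1/\varepsilon\rceil)$ and outputs a rational $\varepsilon$-Nash equilibrium of $G$ (each probability as a numerator and a positive denominator). Here $s$ is the bit size of the input, which lists $\varepsilon$, $n$, $m_1,\dots,m_n$ and the entries of the matrices $P_{kl}$ for all ordered pairs $(k,l)$ (with $P_{kk}=0$ included as $m_k\times m_k$ zero blocks), rationals being given by numerator and denominator in binary. -/

import Mathlib

/-! A random access machine over the integers with finitely many scalar registers and arrays,
programmed in a structured language and charged the logarithmic (bit) cost. -/

namespace RAM

/-- A memory configuration: the scalar registers `var 0, var 1, …` and the integer-indexed arrays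
`arr 0, arr 1, …`. A program names only finitely many of them. -/
structure State where
  var : ℕ → ℤ
  arr : ℕ → ℤ → ℤ

/-- The number of binary digits of `|z|`. -/
def bitLength (z : ℤ) : ℕ := Nat.size z.natAbs

/-- Arithmetic expressions; `load a e` reads the cell of array `a` whose address is the value
of `e`. -/
inductive Expr where
  | const (c : ℤ)
  | var (i : ℕ)
  | load (a : ℕ) (e : Expr)
  | add (e₁ e₂ : Expr)
  | sub (e₁ e₂ : Expr)
  | mul (e₁ e₂ : Expr)
  | div (e₁ e₂ : Expr)

/-- The value of an expression (`div` is integer division, with value `0` for divisor `0`). -/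
def Expr.eval (s : State) : Expr → ℤ
  | .const c => c
  | .var i => s.var i
  | .load a e => s.arr a (e.eval s)
  | .add e₁ e₂ => e₁.eval s + e₂.eval s
  | .sub e₁ e₂ => e₁.eval s - e₂.eval s
  | .mul e₁ e₂ => e₁.eval s * e₂.eval s
  | .div e₁ e₂ => e₁.eval s / e₂.eval s

/-- The logarithmic cost of evaluating an expression: every constant, memory access and operation
costs one plus the bit length of the value it produces, on top of the cost of its operands
(for `load`, of its address). -/
def Expr.cost (s : State) : Expr → ℕ
  | .const c => 1 + bitLength c
  | .var i => 1 + bitLength (s.var i)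
  | .load a e => 1 + bitLength (s.arr a (e.eval s)) + e.cost s
  | .add e₁ e₂ => 1 + bitLength (e₁.eval s + e₂.eval s) + e₁.cost s + e₂.cost s
  | .sub e₁ e₂ => 1 + bitLength (e₁.eval s - e₂.eval s) + e₁.cost s + e₂.cost s
  | .mul e₁ e₂ => 1 + bitLength (e₁.eval s * e₂.eval s) + e₁.cost s + e₂.cost s
  | .div e₁ e₂ => 1 + bitLength (e₁.eval s / e₂.eval s) + e₁.cost s + e₂.cost s

/-- Programs. The tests of `ite e c₁ c₂` (if-then-else) and of `loop e c` (while) are `0 < e`. -/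
inductive Program where
  | skip
  | assign (i : ℕ) (e : Expr)
  | store (a : ℕ) (addr e : Expr)
  | seq (c₁ c₂ : Program)
  | ite (e : Expr) (c₁ c₂ : Program)
  | loop (e : Expr) (c : Program)

/-- `Exec c s s' t`: started in the configuration `s`, the program `c` halts in the configuration
`s'` at total cost `t`. At most one rule applies to every program and configuration, so that
execution is deterministic. -/
inductive Exec : Program → State → State → ℕ → Prop
  | skip (s : State) : Exec .skip s s 1
  | assign (i : ℕ) (e : Expr) (s : State) :
      Exec (.assign i e) s { s with var := Function.update s.var i (e.eval s) } (1 + e.cost s)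
  | store (a : ℕ) (addr e : Expr) (s : State) :
      Exec (.store a addr e) s
        { s with
          arr := Function.update s.arr a (Function.update (s.arr a) (addr.eval s) (e.eval s)) }
        (1 + addr.cost s + e.cost s)
  | seq {c₁ c₂ : Program} {s s' s'' : State} {t₁ t₂ : ℕ} :
      Exec c₁ s s' t₁ → Exec c₂ s' s'' t₂ → Exec (.seq c₁ c₂) s s'' (t₁ + t₂)
  | ite_true {e : Expr} {c₁ c₂ : Program} {s s' : State} {t : ℕ} :
      0 < e.eval s → Exec c₁ s s' t → Exec (.ite e c₁ c₂) s s' (1 + e.cost s + t)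
  | ite_false {e : Expr} {c₁ c₂ : Program} {s s' : State} {t : ℕ} :
      ¬ 0 < e.eval s → Exec c₂ s s' t → Exec (.ite e c₁ c₂) s s' (1 + e.cost s + t)
  | loop_true {e : Expr} {c : Program} {s s' s'' : State} {t₁ t₂ : ℕ} :
      0 < e.eval s → Exec c s s' t₁ → Exec (.loop e c) s' s'' t₂ →
        Exec (.loop e c) s s'' (1 + e.cost s + t₁ + t₂)
  | loop_false {e : Expr} {c : Program} {s : State} :
      ¬ 0 < e.eval s → Exec (.loop e c) s s (1 + e.cost s)

/-- The initial configuration on an input word: its length is in `var 0`, its letters are in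
`arr 0`, and all other cells are zero. -/
def initial (input : List ℤ) : State where
  var i := if i = 0 then (input.length : ℤ) else 0
  arr a j := if a = 0 ∧ 0 ≤ j then input.getD j.toNat 0 else 0

/-- On `input`, the program `c` halts at total cost `t` with the word `output` in `arr 0`, and the
length of `output` in `var 0`. -/
def Computes (c : Program) (input output : List ℤ) (t : ℕ) : Prop :=
  ∃ s : State, Exec c (initial input) s t ∧ s.var 0 = (output.length : ℤ) ∧
    ∀ (i : ℕ) (hi : i < output.length), s.arr 0 (i : ℤ) = output[i]

/-- The bit size of a word of integers written in binary. -/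
def wordSize (w : List ℤ) : ℕ := (w.map fun z => 1 + bitLength z).sum

end RAM

/-- A polymatrix game in polymatrix form, with rational payoffs: player `k` has the pure strategies
`Fin (numActions k)`, and `payoff k l` is the payoff matrix of player `k` in the bimatrix game
between `k` and `l ≠ k`. Diagonal blocks, which have no meaning, are set to zero. -/
structure PolymatrixGame where
  numPlayers : ℕ
  numActions : Fin numPlayers → ℕ
  payoff : (k l : Fin numPlayers) → Matrix (Fin (numActions k)) (Fin (numActions l)) ℚ
  payoff_self : ∀ k, payoff k k = 0

namespace PolymatrixGame

/-- Joint pure actions. -/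
abbrev JointAction (G : PolymatrixGame) : Type := (k : Fin G.numPlayers) → Fin (G.numActions k)

/-- Families of real vectors, one vector for each player. -/
abbrev Profile (G : PolymatrixGame) : Type := (k : Fin G.numPlayers) → Fin (G.numActions k) → ℝ

/-- The payoff of player `k` at a joint pure action. -/
def pureUtility (G : PolymatrixGame) (k : Fin G.numPlayers) (a : G.JointAction) : ℚ :=
  ∑ l ∈ Finset.univ.erase k, G.payoff k l (a k) (a l)

/-- All utilities take values in the unit interval. -/
def UnitPayoffs (G : PolymatrixGame) : Prop :=
  ∀ (k : Fin G.numPlayers) (a : G.JointAction), 0 ≤ G.pureUtility k a ∧ G.pureUtility k a ≤ 1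

/-- The multilinear extension of the payoff of player `k`, i.e. the expected payoff. -/
noncomputable def utility (G : PolymatrixGame) (k : Fin G.numPlayers) (x : G.Profile) : ℝ :=
  ∑ a : G.JointAction, (G.pureUtility k a : ℝ) * ∏ j, x j (a j)

/-- `x` is a joint mixed strategy. -/
def IsStrategy (G : PolymatrixGame) (x : G.Profile) : Prop :=
  ∀ k, x k ∈ stdSimplex ℝ (Fin (G.numActions k))

/-- `x` is an `ε`-Nash equilibrium. -/
def IsApproxNash (G : PolymatrixGame) (ε : ℝ) (x : G.Profile) : Prop :=
  G.IsStrategy x ∧ ∀ k, ∀ z ∈ stdSimplex ℝ (Fin (G.numActions k)),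
    G.utility k (Function.update x k z) ≤ G.utility k x + ε

/-- The game has a Nash equilibrium in which every pure strategy of every player has positive
probability. -/
def HasInteriorNash (G : PolymatrixGame) : Prop :=
  ∃ x : G.Profile, G.IsApproxNash 0 x ∧ ∀ k i, 0 < x k i

/-- The input word for the game `G` and the accuracy `ε`: first `ε`, the number of players and the
numbers of actions, then all payoff matrices. Rationals are given by numerator and denominator. -/
def encode (G : PolymatrixGame) (ε : ℚ) : List ℤ :=
  [ε.num, (ε.den : ℤ), (G.numPlayers : ℤ)] ++
    (List.finRange G.numPlayers).map (fun k => (G.numActions k : ℤ)) ++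
    (List.finRange G.numPlayers).flatMap fun k =>
      (List.finRange G.numPlayers).flatMap fun l =>
        (List.finRange (G.numActions k)).flatMap fun i =>
          (List.finRange (G.numActions l)).flatMap fun j =>
            [(G.payoff k l i j).num, ((G.payoff k l i j).den : ℤ)]

/-- The output word `w` lists the entries of the profile `x` player by player, each as a
numerator followed by a positive denominator (not necessarily in lowest terms). -/
def Represents (G : PolymatrixGame) (w : List ℤ) (x : G.Profile) : Prop :=
  ∃ num den : (k : Fin G.numPlayers) → Fin (G.numActions k) → ℤ,
    (∀ k i, 0 < den k i ∧ x k i = (num k i : ℝ) / (den k i : ℝ)) ∧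
    w = (List.finRange G.numPlayers).flatMap fun k =>
      (List.finRange (G.numActions k)).flatMap fun i => [num k i, den k i]

/-- A fully polynomial-time deterministic approximation scheme for Nash equilibria on a class `C`
of polymatrix games: one program which, given a game of the class and a rational `ε > 0`, computes
an `ε`-Nash equilibrium in time polynomial in the size of the input and in `1 / ε`. -/
def AdmitsNashFPTAS (C : Set PolymatrixGame) : Prop :=
  ∃ (c : RAM.Program) (p : Polynomial ℕ), ∀ G ∈ C, ∀ ε : ℚ, 0 < ε →
    ∃ (w : List ℤ) (t : ℕ) (x : G.Profile),
      RAM.Computes c (G.encode ε) w t ∧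
      t ≤ p.eval (RAM.wordSize (G.encode ε) + ⌈1 / ε⌉₊) ∧
      G.Represents w x ∧ G.IsApproxNash (ε : ℝ) x

end PolymatrixGame

/-! In an interior equilibrium `x` all pure strategies of a player earn the same
(`actionPayoff_eq_of_interior`). Conversely, a profile at which every action payoff of a player is
within `ε / 2` of that of a reference action is an `ε`-equilibrium (`isApproxNash_of_abs_le`). So it
suffices to make the vector of payoff differences small. For a polymatrix game this vector is linear
in the profile, and it vanishes at `x`.

A greedy balancing scheme does this. Let `S` be the sum of the payoff differences of the joint
actions played so far. In the next round each player `l` separately takes the action whose effect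
has the least inner product with `S`. A minimum is at most the average with weights `x l`, and these
averages sum to zero over `l`, so the inner product of `S` with the increment is at most zero. Every
coordinate of the increment lies in `[-1, 1]` by normalization. Hence the squared norm of `S` grows
by at most the total number `M` of actions per round (`sum_sq_cumulated_le`), and after `T ≥ 4 * M /
ε ^ 2` rounds every coordinate of `S / T` is at most `ε / 2` in absolute value. But `S / T` is the
difference vector of the empirical frequencies (`cumulated_eq`), which are therefore the desired
equilibrium (`frequency_isApproxNash`). The point `x` enters the analysis only; the algorithm never
looks for it.

For the bit cost, all payoffs are multiplied by the product of their denominators, so the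
computation is exact integer arithmetic. The program is not written out: `Ctx.PolyTime` is closed
under arithmetic, branching and bounded iteration (`PolyTime.fold`), `achieves_fill` tabulates a
sequence whose terms depend on earlier ones, and `exists_program` combines these. -/

namespace RAM

/-! ### Bit lengths -/

theorem bitLength_le_iff {z : ℤ} {n : ℕ} : bitLength z ≤ n ↔ z.natAbs < 2 ^ n := Nat.size_le

theorem natAbs_lt_two_pow_bitLength (z : ℤ) : z.natAbs < 2 ^ bitLength z :=
  bitLength_le_iff.1 le_rfl

theorem bitLength_mono {x y : ℤ} (h : x.natAbs ≤ y.natAbs) : bitLength x ≤ bitLength y :=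
  Nat.size_le_size h

theorem bitLength_natCast_le (n : ℕ) : bitLength (n : ℤ) ≤ n :=
  bitLength_le_iff.2 (by simpa using Nat.lt_two_pow_self)

theorem bitLength_mul_le (x y : ℤ) : bitLength (x * y) ≤ bitLength x + bitLength y := by
  rw [bitLength_le_iff, Int.natAbs_mul, pow_add]
  exact Nat.mul_lt_mul'' (natAbs_lt_two_pow_bitLength x) (natAbs_lt_two_pow_bitLength y)

theorem bitLength_le_of_natAbs_le_add {x y z : ℤ} (h : z.natAbs ≤ x.natAbs + y.natAbs) :
    bitLength z ≤ bitLength x + bitLength y + 1 := by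
  rw [bitLength_le_iff]
  have hx := natAbs_lt_two_pow_bitLength x
  have hy := natAbs_lt_two_pow_bitLength y
  have h1 : 2 ^ bitLength x ≤ 2 ^ (bitLength x + bitLength y) :=
    Nat.pow_le_pow_right (by norm_num) (by omega)
  have h2 : 2 ^ bitLength y ≤ 2 ^ (bitLength x + bitLength y) :=
    Nat.pow_le_pow_right (by norm_num) (by omega)
  rw [pow_succ]
  omega

theorem bitLength_add_le (x y : ℤ) : bitLength (x + y) ≤ bitLength x + bitLength y + 1 :=
  bitLength_le_of_natAbs_le_add (Int.natAbs_add_le x y)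

theorem bitLength_sub_le (x y : ℤ) : bitLength (x - y) ≤ bitLength x + bitLength y + 1 :=
  bitLength_le_of_natAbs_le_add (Int.natAbs_sub_le x y)

theorem bitLength_div_le (x y : ℤ) : bitLength (x / y) ≤ bitLength x :=
  bitLength_mono (Int.natAbs_ediv_le_natAbs x y)

/-- The crude `n` in place of `log n` suffices, since loop bounds are polynomial in value and not
only in length. -/
theorem bitLength_sum_range_le (f : ℕ → ℤ) (n β : ℕ) (h : ∀ j < n, bitLength (f j) ≤ β) :
    bitLength (∑ j ∈ Finset.range n, f j) ≤ n + β := by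
  rw [bitLength_le_iff, pow_add]
  rcases Nat.eq_zero_or_pos n with rfl | hn
  · simp
  calc (∑ j ∈ Finset.range n, f j).natAbs ≤ ∑ j ∈ Finset.range n, (f j).natAbs :=
        Int.natAbs_sum_le _ _
    _ ≤ ∑ _j ∈ Finset.range n, 2 ^ β :=
        Finset.sum_le_sum fun j hj => (bitLength_le_iff.1 (h j (Finset.mem_range.1 hj))).le
    _ = n * 2 ^ β := by simp
    _ < 2 ^ n * 2 ^ β := Nat.mul_lt_mul_of_pos_right Nat.lt_two_pow_self (by positivity)

theorem bitLength_prod_range_le (f : ℕ → ℤ) (n β : ℕ) (h : ∀ j < n, bitLength (f j) ≤ β) :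
    bitLength (∏ j ∈ Finset.range n, f j) ≤ n * β + 1 := by
  induction n with
  | zero => simp [bitLength_le_iff]
  | succ n ih =>
    rw [Finset.prod_range_succ]
    have h1 := bitLength_mul_le (∏ j ∈ Finset.range n, f j) (f n)
    have h2 := ih fun j hj => h j (by omega)
    have h3 := h n (by omega)
    rw [Nat.succ_mul]
    omega

/-! ### Contexts -/

/-- A ghost parameter type together with a size, the number of reserved registers and the relation
between ghost parameters and configurations. The relation only depends on the arrays and the
reserved registers. -/
structure Ctx (Γ : Type) where
  size : Γ → ℕ
  depth : ℕ
  rel : Γ → State → Prop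
  stable : ∀ γ s s', rel γ s → s'.arr = s.arr → (∀ i < depth, s'.var i = s.var i) → rel γ s'

namespace Ctx

variable {Γ Δ : Type}

/-- The range `{0, …, b - 1}` of a loop whose index is kept in register `d`. -/
def ext (C : Ctx Γ) (b : Γ → ℕ) (d : ℕ) (h : C.depth ≤ d) : Ctx (Γ × ℕ) where
  size p := C.size p.1
  depth := d + 1
  rel p s := C.rel p.1 s ∧ p.2 < b p.1 ∧ s.var d = p.2
  stable := fun p s s' hs ha hv =>
    ⟨C.stable _ s s' hs.1 ha fun i hi => hv i (by omega), hs.2.1, by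
      rw [hv d (by omega)]; exact hs.2.2⟩

/-- The context in which register `d` holds the value of `F`. -/
def push (C : Ctx Γ) (F : Γ → ℤ) (d : ℕ) (h : C.depth ≤ d) : Ctx Γ where
  size := C.size
  depth := d + 1
  rel γ s := C.rel γ s ∧ s.var d = F γ
  stable := fun γ s s' hs ha hv =>
    ⟨C.stable _ s s' hs.1 ha fun i hi => hv i (by omega), by rw [hv d (by omega)]; exact hs.2⟩

/-- The context with an additional assertion about the arrays. -/
def withArr (C : Ctx Γ) (R : Γ → (ℕ → ℤ → ℤ) → Prop) : Ctx Γ where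
  size := C.size
  depth := C.depth
  rel γ s := C.rel γ s ∧ R γ s.arr
  stable := fun γ s s' hs ha hv => ⟨C.stable _ s s' hs.1 ha hv, by rw [ha]; exact hs.2⟩

/-- Polynomially bounded in the size of the context. -/
def PolyBounded (C : Ctx Γ) (f : Γ → ℕ) : Prop :=
  ∃ k, ∀ γ s, C.rel γ s → f γ ≤ (C.size γ + 2) ^ k

variable {C : Ctx Γ}

theorem PolyBounded.mono {f g : Γ → ℕ} (hg : C.PolyBounded g)
    (h : ∀ γ s, C.rel γ s → f γ ≤ g γ) : C.PolyBounded f := by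
  obtain ⟨k, hk⟩ := hg
  exact ⟨k, fun γ s hs => (h γ s hs).trans (hk γ s hs)⟩

/-- The base `C.size γ + 2` is at least `2`, so a power of it absorbs any constant, and sums and
products are handled by adding exponents. -/
theorem polyBounded_const (n : ℕ) : C.PolyBounded fun _ => n :=
  ⟨n, fun γ _ _ => (Nat.lt_two_pow_self (n := n)).le.trans (Nat.pow_le_pow_left (by omega) n)⟩

theorem polyBounded_size : C.PolyBounded C.size := ⟨1, fun γ _ _ => by simp⟩

theorem PolyBounded.mul {f g : Γ → ℕ} (hf : C.PolyBounded f) (hg : C.PolyBounded g) :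
    C.PolyBounded fun γ => f γ * g γ := by
  obtain ⟨k, hk⟩ := hf
  obtain ⟨l, hl⟩ := hg
  exact ⟨k + l, fun γ s hs => by rw [pow_add]; exact Nat.mul_le_mul (hk γ s hs) (hl γ s hs)⟩

theorem PolyBounded.add {f g : Γ → ℕ} (hf : C.PolyBounded f) (hg : C.PolyBounded g) :
    C.PolyBounded fun γ => f γ + g γ := by
  obtain ⟨k, hk⟩ := hf
  obtain ⟨l, hl⟩ := hg
  refine ⟨k + l + 1, fun γ s hs => ?_⟩
  have h1 := hk γ s hs
  have h2 := hl γ s hs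
  have h3 : (C.size γ + 2) ^ k ≤ (C.size γ + 2) ^ (k + l) :=
    Nat.pow_le_pow_right (by omega) (by omega)
  have h4 : (C.size γ + 2) ^ l ≤ (C.size γ + 2) ^ (k + l) :=
    Nat.pow_le_pow_right (by omega) (by omega)
  calc f γ + g γ ≤ (C.size γ + 2) ^ (k + l) * 2 := by omega
    _ ≤ (C.size γ + 2) ^ (k + l + 1) := by
      rw [pow_succ]; exact Nat.mul_le_mul_left _ (by omega)

/-- `C'` refines `C` along `π`: facts of `C` at `π δ` hold in `C'` at `δ`. -/
structure Refines (C' : Ctx Δ) (C : Ctx Γ) (π : Δ → Γ) : Prop where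
  size : ∀ δ, C'.size δ = C.size (π δ)
  depth : C.depth ≤ C'.depth
  rel : ∀ δ s, C'.rel δ s → C.rel (π δ) s

theorem PolyBounded.comap {C' : Ctx Δ} {π : Δ → Γ} (h : C'.Refines C π) {f : Γ → ℕ}
    (hf : C.PolyBounded f) : C'.PolyBounded fun δ => f (π δ) := by
  obtain ⟨k, hk⟩ := hf
  exact ⟨k, fun δ s hs => by rw [h.size]; exact hk _ s (h.rel δ s hs)⟩

theorem Refines.trans {Ξ : Type} {C'' : Ctx Ξ} {C' : Ctx Δ} {π : Δ → Γ} {π' : Ξ → Δ}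
    (h' : C''.Refines C' π') (h : C'.Refines C π) : C''.Refines C (π ∘ π') :=
  ⟨fun ξ => by rw [h'.size, h.size]; rfl, h.depth.trans h'.depth,
    fun ξ s hs => h.rel _ s (h'.rel ξ s hs)⟩

theorem refines_ext (b : Γ → ℕ) (d : ℕ) (h : C.depth ≤ d) :
    (C.ext b d h).Refines C Prod.fst :=
  ⟨fun _ => rfl, h.trans (Nat.le_succ d), fun _ _ hs => hs.1⟩

theorem refines_push (F : Γ → ℤ) (d : ℕ) (h : C.depth ≤ d) :
    (C.push F d h).Refines C id :=
  ⟨fun _ => rfl, h.trans (Nat.le_succ d), fun _ _ hs => hs.1⟩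

theorem refines_withArr (R : Γ → (ℕ → ℤ → ℤ) → Prop) : (C.withArr R).Refines C id :=
  ⟨fun _ => rfl, le_rfl, fun _ _ hs => hs.1⟩

/-! ### Evaluation of functions of the ghost parameters -/

/-- Some program puts the value of `F` into register `d` in polynomial time, without changing the
arrays and the registers below `d`. -/
def EvalsAt (C : Ctx Γ) (F : Γ → ℤ) (d : ℕ) : Prop :=
  ∃ (c : Program) (τ : Γ → ℕ), C.PolyBounded τ ∧ ∀ γ s, C.rel γ s → ∃ s' t, Exec c s s' t ∧
    t ≤ τ γ ∧ s'.arr = s.arr ∧ (∀ i < d, s'.var i = s.var i) ∧ s'.var d = F γ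

/-- `F` has polynomially many bits, and it can be evaluated in polynomial time into every register
that is not reserved. -/
def PolyTime (C : Ctx Γ) (F : Γ → ℤ) : Prop :=
  C.PolyBounded (fun γ => bitLength (F γ)) ∧ ∀ d, C.depth ≤ d → C.EvalsAt F d

/-- Weakening: what is computable outside a loop stays computable inside it, with the same programs,
since a finer context only reserves more registers. -/
theorem PolyTime.comap {C' : Ctx Δ} {π : Δ → Γ} (h : C'.Refines C π) {F : Γ → ℤ}
    (hF : C.PolyTime F) : C'.PolyTime fun δ => F (π δ) := by
  refine ⟨hF.1.comap h, fun d hd => ?_⟩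
  obtain ⟨c, τ, hτ, hc⟩ := hF.2 d (h.depth.trans hd)
  exact ⟨c, fun δ => τ (π δ), hτ.comap h, fun δ s hs => hc _ s (h.rel δ s hs)⟩

theorem PolyTime.congr {F G : Γ → ℤ} (hF : C.PolyTime F)
    (h : ∀ γ s, C.rel γ s → G γ = F γ) : C.PolyTime G := by
  refine ⟨hF.1.mono fun γ s hs => by rw [h γ s hs], fun d hd => ?_⟩
  obtain ⟨c, τ, hτ, hc⟩ := hF.2 d hd
  exact ⟨c, τ, hτ, fun γ s hs => by rw [h γ s hs]; exact hc γ s hs⟩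

theorem exec_assign {i : ℕ} {e : Expr} (s : State) :
    ∃ s', Exec (.assign i e) s s' (1 + e.cost s) ∧ s'.arr = s.arr ∧
      (∀ j, j ≠ i → s'.var j = s.var j) ∧ s'.var i = e.eval s :=
  ⟨_, .assign i e s, rfl, fun _ hj => Function.update_of_ne hj _ _, Function.update_self _ _ _⟩

theorem PolyTime.const (c : ℤ) : C.PolyTime fun _ => c := by
  refine ⟨polyBounded_const _, fun d _ => ⟨.assign d (.const c), _,
    polyBounded_const (1 + (1 + bitLength c)), fun γ s _ => ?_⟩⟩
  obtain ⟨s', h, ha, hv, hd⟩ := exec_assign (i := d) (e := .const c) s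
  exact ⟨s', _, h, le_rfl, ha, fun i hi => hv i hi.ne, hd⟩

theorem PolyTime.var {F : Γ → ℤ} (i : ℕ) (hF : C.PolyBounded fun γ => bitLength (F γ))
    (h : ∀ γ s, C.rel γ s → s.var i = F γ) : C.PolyTime F := by
  refine ⟨hF, fun d _ => ⟨.assign d (.var i), fun γ => 1 + (1 + bitLength (F γ)),
    (polyBounded_const 1).add ((polyBounded_const 1).add hF), fun γ s hs => ?_⟩⟩
  obtain ⟨s', hx, ha, hv, hd⟩ := exec_assign (i := d) (e := .var i) s
  refine ⟨s', _, hx, ?_, ha, fun i hi => hv i hi.ne, hd.trans (h γ s hs)⟩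
  simp [Expr.cost, h γ s hs]

theorem PolyTime.load {A F : Γ → ℤ} (a : ℕ) (hA : C.PolyTime A)
    (hF : C.PolyBounded fun γ => bitLength (F γ))
    (h : ∀ γ s, C.rel γ s → s.arr a (A γ) = F γ) : C.PolyTime F := by
  refine ⟨hF, fun d hd => ?_⟩
  obtain ⟨c, τ, hτ, hc⟩ := hA.2 d hd
  refine ⟨.seq c (.assign d (.load a (.var d))),
    fun γ => τ γ + (1 + (1 + bitLength (F γ) + (1 + bitLength (A γ)))),
    hτ.add ((polyBounded_const 1).add (((polyBounded_const 1).add hF).add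
      ((polyBounded_const 1).add hA.1))), fun γ s hs => ?_⟩
  obtain ⟨s₁, t₁, h₁, ht₁, ha₁, hv₁, hd₁⟩ := hc γ s hs
  obtain ⟨s₂, h₂, ha₂, hv₂, hd₂⟩ := exec_assign (i := d) (e := .load a (.var d)) s₁
  have he : s₁.arr a (s₁.var d) = F γ := by rw [hd₁, ha₁, h γ s hs]
  refine ⟨s₂, _, h₁.seq h₂, ?_, ha₂.trans ha₁, fun i hi => (hv₂ i hi.ne).trans (hv₁ i hi), ?_⟩
  · simp only [Expr.cost, Expr.eval, he]
    rw [hd₁]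
    omega
  · rw [hd₂]; simpa [Expr.eval] using he

theorem PolyTime.binary {op : Expr → Expr → Expr} {o : ℤ → ℤ → ℤ}
    (heval : ∀ s e₁ e₂, (op e₁ e₂).eval s = o (e₁.eval s) (e₂.eval s))
    (hcost : ∀ s e₁ e₂, (op e₁ e₂).cost s =
      1 + bitLength (o (e₁.eval s) (e₂.eval s)) + e₁.cost s + e₂.cost s)
    (hbit : ∀ x y, bitLength (o x y) ≤ bitLength x + bitLength y + 1)
    {F G : Γ → ℤ} (hF : C.PolyTime F) (hG : C.PolyTime G) :
    C.PolyTime fun γ => o (F γ) (G γ) := by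
  have hb : C.PolyBounded fun γ => bitLength (o (F γ) (G γ)) :=
    ((hF.1.add hG.1).add (polyBounded_const 1)).mono fun γ _ _ => hbit _ _
  refine ⟨hb, fun d hd => ?_⟩
  obtain ⟨c₁, τ₁, hτ₁, hc₁⟩ := hF.2 d hd
  -- Evaluating the second operand into `d + 1` protects all registers below, in particular the
  -- first operand in `d`.
  obtain ⟨c₂, τ₂, hτ₂, hc₂⟩ := hG.2 (d + 1) (by omega)
  refine ⟨.seq c₁ (.seq c₂ (.assign d (op (.var d) (.var (d + 1))))),
    fun γ => τ₁ γ + (τ₂ γ + (1 + (1 + bitLength (o (F γ) (G γ)) + (1 + bitLength (F γ)) +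
      (1 + bitLength (G γ))))),
    hτ₁.add (hτ₂.add ((polyBounded_const 1).add ((((polyBounded_const 1).add hb).add
      ((polyBounded_const 1).add hF.1)).add ((polyBounded_const 1).add hG.1)))),
    fun γ s hs => ?_⟩
  obtain ⟨s₁, t₁, h₁, ht₁, ha₁, hv₁, hd₁⟩ := hc₁ γ s hs
  obtain ⟨s₂, t₂, h₂, ht₂, ha₂, hv₂, hd₂⟩ := hc₂ γ s₁
    (C.stable γ s s₁ hs ha₁ fun i hi => hv₁ i (by omega))
  obtain ⟨s₃, h₃, ha₃, hv₃, hd₃⟩ := exec_assign (i := d) (e := op (.var d) (.var (d + 1))) s₂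
  have e₁ : s₂.var d = F γ := (hv₂ d (by omega)).trans hd₁
  refine ⟨s₃, _, h₁.seq (h₂.seq h₃), ?_, ha₃.trans (ha₂.trans ha₁), fun i hi =>
    (hv₃ i hi.ne).trans ((hv₂ i (by omega)).trans (hv₁ i hi)), ?_⟩
  · rw [hcost]
    simp only [Expr.cost, Expr.eval, e₁, hd₂]
    omega
  · rw [hd₃, heval]; simp only [Expr.eval, e₁, hd₂]

theorem PolyTime.add {F G : Γ → ℤ} (hF : C.PolyTime F) (hG : C.PolyTime G) :
    C.PolyTime fun γ => F γ + G γ :=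
  .binary (op := .add) (o := fun x y => x + y) (fun _ _ _ => rfl) (fun _ _ _ => rfl)
    bitLength_add_le hF hG

theorem PolyTime.sub {F G : Γ → ℤ} (hF : C.PolyTime F) (hG : C.PolyTime G) :
    C.PolyTime fun γ => F γ - G γ :=
  .binary (op := .sub) (o := fun x y => x - y) (fun _ _ _ => rfl) (fun _ _ _ => rfl)
    bitLength_sub_le hF hG

theorem PolyTime.mul {F G : Γ → ℤ} (hF : C.PolyTime F) (hG : C.PolyTime G) :
    C.PolyTime fun γ => F γ * G γ :=
  .binary (op := .mul) (o := fun x y => x * y) (fun _ _ _ => rfl) (fun _ _ _ => rfl)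
    (fun x y => (bitLength_mul_le x y).trans (Nat.le_succ _)) hF hG

theorem PolyTime.div {F G : Γ → ℤ} (hF : C.PolyTime F) (hG : C.PolyTime G) :
    C.PolyTime fun γ => F γ / G γ :=
  .binary (op := .div) (o := fun x y => x / y) (fun _ _ _ => rfl) (fun _ _ _ => rfl)
    (fun x y => (bitLength_div_le x y).trans (by omega)) hF hG

theorem PolyTime.ite {E F G : Γ → ℤ} (hE : C.PolyTime E) (hF : C.PolyTime F)
    (hG : C.PolyTime G) : C.PolyTime fun γ => if 0 < E γ then F γ else G γ := by
  have hb : C.PolyBounded fun γ => bitLength (if 0 < E γ then F γ else G γ) :=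
    (hF.1.add hG.1).mono fun γ _ _ => by split_ifs <;> omega
  refine ⟨hb, fun d hd => ?_⟩
  obtain ⟨c₀, τ₀, hτ₀, hc₀⟩ := hE.2 d hd
  obtain ⟨c₁, τ₁, hτ₁, hc₁⟩ := hF.2 d hd
  obtain ⟨c₂, τ₂, hτ₂, hc₂⟩ := hG.2 d hd
  refine ⟨.seq c₀ (.ite (.var d) c₁ c₂),
    fun γ => τ₀ γ + (1 + (1 + bitLength (E γ)) + (τ₁ γ + τ₂ γ)),
    hτ₀.add (((polyBounded_const 1).add ((polyBounded_const 1).add hE.1)).add (hτ₁.add hτ₂)),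
    fun γ s hs => ?_⟩
  obtain ⟨s₁, t₁, h₁, ht₁, ha₁, hv₁, hd₁⟩ := hc₀ γ s hs
  have hs₁ := C.stable γ s s₁ hs ha₁ fun i hi => hv₁ i (by omega)
  by_cases h0 : 0 < E γ
  · obtain ⟨s₂, t₂, h₂, ht₂, ha₂, hv₂, hd₂⟩ := hc₁ γ s₁ hs₁
    refine ⟨s₂, _, h₁.seq (.ite_true (by simpa [Expr.eval, hd₁] using h0) h₂), ?_,
      ha₂.trans ha₁, fun i hi => (hv₂ i hi).trans (hv₁ i hi), hd₂.trans (if_pos h0).symm⟩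
    simp only [Expr.cost, hd₁]
    omega
  · obtain ⟨s₂, t₂, h₂, ht₂, ha₂, hv₂, hd₂⟩ := hc₂ γ s₁ hs₁
    refine ⟨s₂, _, h₁.seq (.ite_false (by simpa [Expr.eval, hd₁] using h0) h₂), ?_,
      ha₂.trans ha₁, fun i hi => (hv₂ i hi).trans (hv₁ i hi), hd₂.trans (if_neg h0).symm⟩
    simp only [Expr.cost, hd₁]
    omega

theorem PolyTime.ite_lt {D E F G : Γ → ℤ} (hD : C.PolyTime D) (hE : C.PolyTime E)
    (hF : C.PolyTime F) (hG : C.PolyTime G) :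
    C.PolyTime fun γ => if D γ < E γ then F γ else G γ := by
  simpa only [sub_pos] using (hE.sub hD).ite hF hG

/-- The machine tests only positivity, so equality is decided by two strict comparisons. -/
theorem PolyTime.ite_eq {D E : Γ → ℕ} {F G : Γ → ℤ} (hD : C.PolyTime fun γ => (D γ : ℤ))
    (hE : C.PolyTime fun γ => (E γ : ℤ)) (hF : C.PolyTime F) (hG : C.PolyTime G) :
    C.PolyTime fun γ => if D γ = E γ then F γ else G γ := by
  refine (hD.ite_lt hE hG (hE.ite_lt hD hG hF)).congr fun γ _ _ => ?_
  rcases lt_trichotomy (D γ) (E γ) with h | h | h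
  · simp [h, h.ne]
  · simp [h]
  · have h' : (E γ : ℤ) < D γ := by exact_mod_cast h
    simp [h.ne', h']

/-- A function with polynomially bounded natural values, suited as a loop bound. -/
def SmallNat (C : Ctx Γ) (b : Γ → ℕ) : Prop :=
  C.PolyTime (fun γ => (b γ : ℤ)) ∧ C.PolyBounded b

theorem SmallNat.comap {C' : Ctx Δ} {π : Δ → Γ} (h : C'.Refines C π) {b : Γ → ℕ}
    (hb : C.SmallNat b) : C'.SmallNat fun δ => b (π δ) :=
  ⟨hb.1.comap h, hb.2.comap h⟩

theorem SmallNat.const (n : ℕ) : C.SmallNat fun _ => n := ⟨.const n, polyBounded_const n⟩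

theorem SmallNat.add {b c : Γ → ℕ} (hb : C.SmallNat b) (hc : C.SmallNat c) :
    C.SmallNat fun γ => b γ + c γ :=
  ⟨by simpa using hb.1.add hc.1, hb.2.add hc.2⟩

theorem SmallNat.mul {b c : Γ → ℕ} (hb : C.SmallNat b) (hc : C.SmallNat c) :
    C.SmallNat fun γ => b γ * c γ :=
  ⟨by simpa using hb.1.mul hc.1, hb.2.mul hc.2⟩

theorem SmallNat.div {b c : Γ → ℕ} (hb : C.SmallNat b) (hc : C.SmallNat c) :
    C.SmallNat fun γ => b γ / c γ :=
  ⟨by simpa using hb.1.div hc.1, hb.2.mono fun γ _ _ => Nat.div_le_self _ _⟩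

theorem SmallNat.mod {b c : Γ → ℕ} (hb : C.SmallNat b) (hc : C.SmallNat c) :
    C.SmallNat fun γ => b γ % c γ := by
  refine ⟨(hb.1.sub (hc.1.mul (hb.1.div hc.1))).congr fun γ _ _ => ?_,
    hb.2.mono fun γ _ _ => Nat.mod_le _ _⟩
  rw [Int.natCast_mod, Int.emod_def]

theorem SmallNat.index {b : Γ → ℕ} (hb : C.PolyBounded b) (d : ℕ) (h : C.depth ≤ d) :
    (C.ext b d h).SmallNat fun p => p.2 := by
  have hp : (C.ext b d h).PolyBounded fun p => p.2 :=
    (hb.comap (refines_ext b d h)).mono fun p s hs => hs.2.1.le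
  exact ⟨.var d (hp.mono fun p _ _ => bitLength_natCast_le _) fun p s hs => hs.2.2, hp⟩

/-! ### Loops -/

theorem exec_loop {e : Expr} {c : Program} (Inv : ℕ → State → Prop) (b τ₁ τ₂ : ℕ)
    (hstep : ∀ j < b, ∀ s, Inv j s → 0 < e.eval s ∧ e.cost s ≤ τ₁ ∧
      ∃ s' t, Exec c s s' t ∧ t ≤ τ₂ ∧ Inv (j + 1) s')
    (hend : ∀ s, Inv b s → ¬ 0 < e.eval s ∧ e.cost s ≤ τ₁) (s : State) (hs : Inv 0 s) :
    ∃ s' t, Exec (.loop e c) s s' t ∧ t ≤ (b + 1) * (1 + τ₁ + τ₂) ∧ Inv b s' := by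
  -- Induction on the number `r` of iterations still to come, because `Exec.loop_true` unrolls from
  -- the front. The extra unit in `r + 1` pays for the final failing test.
  suffices H : ∀ r ≤ b, ∀ s, Inv (b - r) s → ∃ s' t, Exec (.loop e c) s s' t ∧
      t ≤ (r + 1) * (1 + τ₁ + τ₂) ∧ Inv b s' from H b le_rfl s (by simpa using hs)
  intro r
  induction r with
  | zero =>
    intro _ s hs
    obtain ⟨h1, h2⟩ := hend s hs
    exact ⟨s, _, .loop_false h1, by omega, hs⟩
  | succ r ih =>
    intro hr s hs
    obtain ⟨h1, h2, s₁, t₁, hx₁, ht₁, hi₁⟩ := hstep _ (by omega) s hs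
    obtain ⟨s₂, t₂, hx₂, ht₂, hi₂⟩ := ih (by omega) s₁
      (by rwa [show b - (r + 1) + 1 = b - r by omega] at hi₁)
    exact ⟨s₂, _, .loop_true h1 hx₁ hx₂, by rw [Nat.succ_mul]; omega, hi₂⟩

/-- Bounded iteration: register `d` holds the index and register `d + 1` the accumulator. -/
theorem PolyTime.fold {b : Γ → ℕ} (hb : C.SmallNat b) (acc : Γ → ℕ → ℤ)
    (h0 : C.PolyTime fun γ => acc γ 0) (β : Γ → ℕ) (hβ : C.PolyBounded β)
    (hacc : ∀ γ s, C.rel γ s → ∀ j ≤ b γ, bitLength (acc γ j) ≤ β γ)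
    (hstep : ∀ d (h : C.depth ≤ d), ((C.ext b d h).push (fun p => acc p.1 p.2) (d + 1)
      le_rfl).PolyTime fun p => acc p.1 (p.2 + 1)) :
    C.PolyTime fun γ => acc γ (b γ) := by
  -- A polynomial bound for a single step would compound over the iterations; the bound `β`, uniform
  -- in the index, excludes this.
  refine ⟨hβ.mono fun γ s hs => hacc γ s hs _ le_rfl, fun d hd => ?_⟩
  obtain ⟨c₀, τ₀, hτ₀, hc₀⟩ := h0.2 (d + 1) (by omega)
  obtain ⟨c₁, τ₁, hτ₁, hc₁⟩ := hb.1.2 (d + 2) (by omega)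
  -- Register `d + 2` keeps the loop bound, so the step works from `d + 3` on and its result is then
  -- copied to `d + 1`.
  obtain ⟨c₂, τ₂, ⟨k, hk⟩, hc₂⟩ := (hstep d hd).2 (d + 3) (by simp [push])
  refine ⟨.seq c₀ (.seq c₁ (.seq (.assign d (.const 0))
    (.seq (.loop (.sub (.var (d + 2)) (.var d)) (.seq c₂ (.seq (.assign (d + 1) (.var (d + 3)))
      (.assign d (.add (.var d) (.const 1)))))) (.assign d (.var (d + 1)))))),
    fun γ => τ₀ γ + (τ₁ γ + (2 + ((b γ + 1) * (1 + (3 + 3 * b γ) +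
      ((C.size γ + 2) ^ k + (2 + β γ + (5 + 2 * b γ)))) + (2 + β γ)))), ?_, fun γ s hs => ?_⟩
  · have hc := fun n => polyBounded_const (C := C) n
    have hkk : C.PolyBounded fun γ => (C.size γ + 2) ^ k := ⟨k, fun _ _ _ => le_rfl⟩
    exact hτ₀.add (hτ₁.add ((hc 2).add ((((hb.2.add (hc 1))).mul (((hc 1).add
      ((hc 3).add ((hc 3).mul hb.2))).add (hkk.add (((hc 2).add hβ).add
        ((hc 5).add ((hc 2).mul hb.2)))))).add ((hc 2).add hβ))))
  obtain ⟨s₁, t₁, h₁, ht₁, ha₁, hv₁, hd₁⟩ := hc₀ γ s hs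
  have hs₁ := C.stable γ s s₁ hs ha₁ fun i hi => hv₁ i (by omega)
  obtain ⟨s₂, t₂, h₂, ht₂, ha₂, hv₂, hd₂⟩ := hc₁ γ s₁ hs₁
  obtain ⟨s₃, h₃, ha₃, hv₃, hd₃⟩ := exec_assign (i := d) (e := .const 0) s₂
  let Inv : ℕ → State → Prop := fun j s' => s'.arr = s.arr ∧ (∀ i < d, s'.var i = s.var i) ∧
    j ≤ b γ ∧ s'.var d = j ∧ s'.var (d + 1) = acc γ j ∧ s'.var (d + 2) = b γ
  have hcost : ∀ j s', Inv j s' →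
      (Expr.sub (.var (d + 2)) (.var d)).cost s' ≤ 3 + 3 * b γ := by
    rintro j s' ⟨-, -, hj, h1, -, h2⟩
    simp only [Expr.cost, Expr.eval, h1, h2]
    have e1 := bitLength_natCast_le (b γ)
    have e2 := bitLength_natCast_le j
    have e3 := bitLength_natCast_le (b γ - j)
    rw [Nat.cast_sub hj] at e3
    omega
  obtain ⟨s₄, t₄, h₄, ht₄, ha₄, hv₄, -, hd₄, hacc₄, -⟩ := exec_loop
    (e := .sub (.var (d + 2)) (.var d)) (c := .seq c₂ (.seq (.assign (d + 1) (.var (d + 3)))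
      (.assign d (.add (.var d) (.const 1))))) Inv (b γ) (3 + 3 * b γ)
    ((C.size γ + 2) ^ k + (2 + β γ + (5 + 2 * b γ))) (by
      intro j hj s' hs'
      have hs0 := hs'
      obtain ⟨ha, hv, -, hd', hac, hbd⟩ := hs'
      refine ⟨by simp [Expr.eval, hd', hbd, hj], hcost j s' hs0, ?_⟩
      have hr : ((C.ext b d hd).push (fun p => acc p.1 p.2) (d + 1) le_rfl).rel (γ, j) s' :=
        ⟨⟨C.stable γ s s' hs ha fun i hi => hv i (by omega), hj, hd'⟩, hac⟩
      obtain ⟨u₁, r₁, hx₁, hr₁, hua₁, huv₁, hud₁⟩ := hc₂ (γ, j) s' hr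
      obtain ⟨u₂, hx₂, hua₂, huv₂, hud₂⟩ := exec_assign (i := d + 1) (e := .var (d + 3)) u₁
      obtain ⟨u₃, hx₃, hua₃, huv₃, hud₃⟩ :=
        exec_assign (i := d) (e := .add (.var d) (.const 1)) u₂
      have hdj : u₂.var d = j := by
        rw [huv₂ d (by omega), huv₁ d (by omega), hd']
      refine ⟨u₃, _, hx₁.seq (hx₂.seq hx₃), ?_, hua₃.trans (hua₂.trans (hua₁.trans ha)), ?_, hj,
        ?_, ?_, ?_⟩
      · have e0 := hk (γ, j) s' hr
        have e1 := hacc γ s hs (j + 1) hj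
        have e2 := bitLength_natCast_le (j + 1)
        have e3 := bitLength_natCast_le j
        have e4 : bitLength 1 = 1 := by decide
        simp only [Expr.cost, Expr.eval, hud₁, hdj, e4]
        simp only [push, ext] at e0
        push_cast at e2
        omega
      · intro i hi
        rw [huv₃ i (by omega), huv₂ i (by omega), huv₁ i (by omega), hv i hi]
      · rw [hud₃]; simp [Expr.eval, hdj]
      · rw [huv₃ _ (by omega), hud₂]; simp [Expr.eval, hud₁]
      · rw [huv₃ _ (by omega), huv₂ _ (by omega), huv₁ _ (by omega), hbd])
    (by
      intro s' hs'
      exact ⟨by obtain ⟨-, -, -, h1, -, h2⟩ := hs'; simp [Expr.eval, h1, h2], hcost _ s' hs'⟩)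
    s₃ ⟨ha₃.trans (ha₂.trans ha₁), fun i hi => by
      rw [hv₃ i (by omega), hv₂ i (by omega), hv₁ i (by omega)], by omega, by simp [hd₃, Expr.eval],
      by rw [hv₃ _ (by omega), hv₂ _ (by omega), hd₁], by rw [hv₃ _ (by omega), hd₂]⟩
  obtain ⟨s₅, h₅, ha₅, hv₅, hd₅⟩ := exec_assign (i := d) (e := .var (d + 1)) s₄
  refine ⟨s₅, _, h₁.seq (h₂.seq (h₃.seq (h₄.seq h₅))), ?_, ha₅.trans ha₄,
    fun i hi => (hv₅ i hi.ne).trans (hv₄ i hi), by rw [hd₅]; simpa [Expr.eval] using hacc₄⟩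
  have e1 := hacc γ s hs (b γ) le_rfl
  have e4 : bitLength 0 = 0 := by decide
  simp only [Expr.cost, hacc₄, e4]
  omega

theorem PolyTime.sum {b : Γ → ℕ} (hb : C.SmallNat b) {F : Γ → ℕ → ℤ}
    (hF : ∀ d (h : C.depth ≤ d), (C.ext b d h).PolyTime fun p => F p.1 p.2) :
    C.PolyTime fun γ => ∑ j ∈ Finset.range (b γ), F γ j := by
  obtain ⟨k, hk⟩ := (hF C.depth le_rfl).1
  refine .fold hb (fun γ j => ∑ i ∈ Finset.range j, F γ i) (by simpa using .const 0)
    (fun γ => b γ + (C.size γ + 2) ^ k) (hb.2.add ⟨k, fun _ _ _ => le_rfl⟩) ?_ ?_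
  · intro γ s hs j hj
    refine (bitLength_sum_range_le _ j ((C.size γ + 2) ^ k) fun i hi => ?_).trans (by omega)
    -- The bit bound for `F γ i` is only known where some configuration of the extended context
    -- exists; writing `i` into the index register produces one.
    exact hk (γ, i) { s with var := Function.update s.var C.depth i }
      ⟨C.stable γ s _ hs rfl fun l hl => Function.update_of_ne hl.ne _ _, hi.trans_le hj,
        Function.update_self _ _ _⟩
  · intro d h
    simp only [Finset.sum_range_succ]
    refine PolyTime.add (.var (d + 1) ?_ fun p s hs => hs.2)
      ((hF d h).comap (refines_push _ _ _))
    have hr := (refines_push (C := C.ext b d h)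
      (fun p => ∑ i ∈ Finset.range p.2, F p.1 i) (d + 1) le_rfl).trans (refines_ext b d h)
    refine ((hb.2.add (f := b) ⟨k, fun _ _ _ => le_rfl⟩).comap hr).mono fun p s hs => ?_
    refine (bitLength_sum_range_le _ p.2 ((C.size p.1 + 2) ^ k) fun i hi => ?_).trans
      (by have := hs.1.2.1; simp; omega)
    exact hk (p.1, i) { s with var := Function.update s.var C.depth i }
      ⟨C.stable p.1 s _ hs.1.1 rfl fun l hl => Function.update_of_ne hl.ne _ _,
        hi.trans hs.1.2.1, Function.update_self _ _ _⟩

theorem PolyTime.prod {b : Γ → ℕ} (hb : C.SmallNat b) {F : Γ → ℕ → ℤ}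
    (hF : ∀ d (h : C.depth ≤ d), (C.ext b d h).PolyTime fun p => F p.1 p.2) :
    C.PolyTime fun γ => ∏ j ∈ Finset.range (b γ), F γ j := by
  obtain ⟨k, hk⟩ := (hF C.depth le_rfl).1
  have hk' : ∀ γ s, C.rel γ s → ∀ i < b γ, bitLength (F γ i) ≤ (C.size γ + 2) ^ k :=
    fun γ s hs i hi => hk (γ, i) { s with var := Function.update s.var C.depth i }
      ⟨C.stable γ s _ hs rfl fun l hl => Function.update_of_ne hl.ne _ _, hi,
        Function.update_self _ _ _⟩
  have hβ : C.PolyBounded fun γ => b γ * (C.size γ + 2) ^ k + 1 :=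
    (hb.2.mul ⟨k, fun _ _ _ => le_rfl⟩).add (polyBounded_const 1)
  have hacc : ∀ γ s, C.rel γ s → ∀ j ≤ b γ,
      bitLength (∏ i ∈ Finset.range j, F γ i) ≤ b γ * (C.size γ + 2) ^ k + 1 :=
    fun γ s hs j hj => (bitLength_prod_range_le _ j _ fun i hi =>
      hk' γ s hs i (hi.trans_le hj)).trans (by gcongr)
  refine .fold hb (fun γ j => ∏ i ∈ Finset.range j, F γ i) (by simpa using .const 1) _ hβ hacc ?_
  intro d h
  simp only [Finset.prod_range_succ]
  refine PolyTime.mul (.var (d + 1) ?_ fun p s hs => hs.2) ((hF d h).comap (refines_push _ _ _))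
  exact (hβ.comap ((refines_push _ _ _).trans (refines_ext b d h))).mono fun p s hs =>
    hacc p.1 s hs.1.1 p.2 hs.1.2.1.le

theorem SmallNat.sum {b : Γ → ℕ} (hb : C.SmallNat b) {F : Γ → ℕ → ℕ}
    (hF : ∀ d (h : C.depth ≤ d), (C.ext b d h).SmallNat fun p => F p.1 p.2) :
    C.SmallNat fun γ => ∑ j ∈ Finset.range (b γ), F γ j := by
  refine ⟨by simpa using PolyTime.sum hb fun d h => (hF d h).1, ?_⟩
  obtain ⟨k, hk⟩ := (hF C.depth le_rfl).2
  refine (hb.2.mul (g := fun γ => (C.size γ + 2) ^ k) ⟨k, fun _ _ _ => le_rfl⟩).mono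
    fun γ s hs => ?_
  refine (Finset.sum_le_card_nsmul _ _ ((C.size γ + 2) ^ k) fun i hi => ?_).trans (by simp)
  exact hk (γ, i) { s with var := Function.update s.var C.depth i }
    ⟨C.stable γ s _ hs rfl fun l hl => Function.update_of_ne hl.ne _ _, Finset.mem_range.1 hi,
      Function.update_self _ _ _⟩

/-! ### Transformations of configurations -/

/-- Some program leads from configurations related by `C` to configurations related by `C'` in
polynomial time. -/
def Achieves (C C' : Ctx Γ) : Prop :=
  C'.size = C.size ∧ ∃ (c : Program) (τ : Γ → ℕ), C.PolyBounded τ ∧ ∀ γ s, C.rel γ s →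
    ∃ s' t, Exec c s s' t ∧ t ≤ τ γ ∧ C'.rel γ s'

theorem Achieves.trans {C' C'' : Ctx Γ} (h : C.Achieves C') (h' : C'.Achieves C'') :
    C.Achieves C'' := by
  obtain ⟨e, c, τ, hτ, hc⟩ := h
  obtain ⟨e', c', τ', ⟨k, hk⟩, hc'⟩ := h'
  -- The bound on `τ'` holds only for parameters with a configuration in `C'`, so its explicit power
  -- is used. Equality of the sizes turns it into a bound for `C`.
  refine ⟨e'.trans e, .seq c c', fun γ => τ γ + (C.size γ + 2) ^ k,
    hτ.add ⟨k, fun _ _ _ => le_rfl⟩, fun γ s hs => ?_⟩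
  obtain ⟨s₁, t₁, h₁, ht₁, hs₁⟩ := hc γ s hs
  obtain ⟨s₂, t₂, h₂, ht₂, hs₂⟩ := hc' γ s₁ hs₁
  have := hk γ s₁ hs₁
  rw [e] at this
  exact ⟨s₂, _, h₁.seq h₂, by simp only; omega, hs₂⟩

/-- Fill the cells `0, …, b - 1` of array `a`; the value of a cell may depend on the cells before
it. -/
theorem achieves_fill {b : Γ → ℕ} (hb : C.SmallNat b) (a : ℕ) (H : Γ → ℕ → ℤ)
    (hC : ∀ γ s x, C.rel γ s → C.rel γ { s with arr := Function.update s.arr a x })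
    (hH : ∀ d (h : C.depth ≤ d), ((C.ext b d h).withArr fun p A =>
      ∀ r < p.2, A a r = H p.1 r).PolyTime fun p => H p.1 p.2) :
    C.Achieves (C.withArr fun γ A => ∀ r < b γ, A a r = H γ r) := by
  refine ⟨rfl, ?_⟩
  set d := C.depth with hdef
  obtain ⟨c₁, τ₁, hτ₁, hc₁⟩ := hb.1.2 (d + 1) (by omega)
  obtain ⟨⟨l, hl⟩, hH'⟩ := hH d le_rfl
  obtain ⟨c₂, τ₂, ⟨k, hk⟩, hc₂⟩ := hH' (d + 2) (by simp [withArr, ext])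
  refine ⟨.seq c₁ (.seq (.assign d (.const 0)) (.loop (.sub (.var (d + 1)) (.var d))
    (.seq c₂ (.seq (.store a (.var d) (.var (d + 2)))
      (.assign d (.add (.var d) (.const 1))))))),
    fun γ => τ₁ γ + (2 + (b γ + 1) * (1 + (3 + 3 * b γ) +
      ((C.size γ + 2) ^ k + ((3 + b γ + (C.size γ + 2) ^ l) + (5 + 2 * b γ))))), ?_,
      fun γ s hs => ?_⟩
  · have hc := fun n => polyBounded_const (C := C) n
    have hkk : ∀ k, C.PolyBounded fun γ => (C.size γ + 2) ^ k :=
      fun k => ⟨k, fun _ _ _ => le_rfl⟩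
    exact hτ₁.add ((hc 2).add ((hb.2.add (hc 1)).mul (((hc 1).add
      ((hc 3).add ((hc 3).mul hb.2))).add ((hkk k).add ((((hc 3).add hb.2).add (hkk l)).add
        ((hc 5).add ((hc 2).mul hb.2)))))))
  obtain ⟨s₁, t₁, h₁, ht₁, ha₁, hv₁, hd₁⟩ := hc₁ γ s hs
  obtain ⟨s₂, h₂, ha₂, hv₂, hd₂⟩ := exec_assign (i := d) (e := .const 0) s₁
  let Inv : ℕ → State → Prop := fun j s' => C.rel γ s' ∧ j ≤ b γ ∧ s'.var d = j ∧
    s'.var (d + 1) = b γ ∧ ∀ r < j, s'.arr a r = H γ r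
  have hcost : ∀ j s', Inv j s' →
      (Expr.sub (.var (d + 1)) (.var d)).cost s' ≤ 3 + 3 * b γ := by
    rintro j s' ⟨-, hj, h1, h2, -⟩
    simp only [Expr.cost, Expr.eval, h1, h2]
    have e1 := bitLength_natCast_le (b γ)
    have e2 := bitLength_natCast_le j
    have e3 := bitLength_natCast_le (b γ - j)
    rw [Nat.cast_sub hj] at e3
    omega
  obtain ⟨s₄, t₄, h₄, ht₄, hr₄, -, -, -, hH₄⟩ := exec_loop
    (e := .sub (.var (d + 1)) (.var d)) (c := .seq c₂ (.seq (.store a (.var d) (.var (d + 2)))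
      (.assign d (.add (.var d) (.const 1))))) Inv (b γ) (3 + 3 * b γ)
    ((C.size γ + 2) ^ k + ((3 + b γ + (C.size γ + 2) ^ l) + (5 + 2 * b γ))) (by
      intro j hj s' hs'
      have hs0 := hs'
      obtain ⟨hrel, -, hd', hbd, hpre⟩ := hs'
      refine ⟨by simp [Expr.eval, hd', hbd, hj], hcost j s' hs0, ?_⟩
      have hr : ((C.ext b d le_rfl).withArr fun p A =>
          ∀ r < p.2, A a r = H p.1 r).rel (γ, j) s' := ⟨⟨hrel, hj, hd'⟩, hpre⟩
      obtain ⟨u₁, r₁, hx₁, hr₁, hua₁, huv₁, hud₁⟩ := hc₂ (γ, j) s' hr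
      have hrel₁ := C.stable γ s' u₁ hrel hua₁ fun i hi => huv₁ i (by omega)
      have hx₂ := Exec.store a (.var d) (.var (d + 2)) u₁
      obtain ⟨u₃, hx₃, hua₃, huv₃, hud₃⟩ := exec_assign (i := d) (e := .add (.var d) (.const 1))
        { u₁ with arr := Function.update u₁.arr a (Function.update (u₁.arr a)
          ((Expr.var d).eval u₁) ((Expr.var (d + 2)).eval u₁)) }
      have hdj : u₁.var d = j := by rw [huv₁ d (by omega), hd']
      refine ⟨u₃, _, hx₁.seq (hx₂.seq hx₃), ?_, ?_, hj, ?_, ?_, ?_⟩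
      · have e0 := hk (γ, j) s' hr
        have e1 := hl (γ, j) s' hr
        have e2 := bitLength_natCast_le (j + 1)
        have e3 := bitLength_natCast_le j
        have e4 : bitLength 1 = 1 := by decide
        simp only [Expr.cost, Expr.eval, hud₁, hdj, e4]
        simp only [withArr, ext] at e0 e1
        push_cast at e2
        omega
      -- By `hC` the context does not look at array `a`, so it survives the store.
      · exact C.stable γ _ u₃ (hC γ u₁ _ hrel₁) hua₃ fun i hi => huv₃ i (by omega)
      · rw [hud₃]; simp [Expr.eval, hdj]
      · rw [huv₃ _ (by omega)]; show u₁.var (d + 1) = _; rw [huv₁ _ (by omega), hbd]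
      · intro r hr'
        rw [hua₃]
        simp only [Function.update_self, Expr.eval, hdj, hud₁]
        rcases Nat.lt_succ_iff_lt_or_eq.1 hr' with h | rfl
        · rw [Function.update_of_ne (by exact_mod_cast h.ne), hua₁, hpre r h]
        · rw [Function.update_self])
    (by
      intro s' hs'
      exact ⟨by obtain ⟨-, -, h1, h2, -⟩ := hs'; simp [Expr.eval, h1, h2], hcost _ s' hs'⟩)
    s₂ ⟨C.stable γ s s₂ hs (ha₂.trans ha₁) fun i hi => by
      rw [hv₂ i (by omega), hv₁ i (by omega)], by omega, by simp [hd₂, Expr.eval],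
      by rw [hv₂ _ (by omega), hd₁], by simp⟩
  refine ⟨s₄, _, h₁.seq (h₂.seq h₄), ?_, hr₄, hH₄⟩
  have e4 : bitLength 0 = 0 := by decide
  simp only [Expr.cost, e4]
  omega

end Ctx

end RAM

/-! ### Input cells and positions of minima -/

namespace RAM

theorem bitLength_le_wordSize {w : List ℤ} {z : ℤ} (h : z ∈ w) : 1 + bitLength z ≤ wordSize w :=
  List.single_le_sum (by simp) _ (List.mem_map_of_mem h)

theorem bitLength_getD_le_wordSize (w : List ℤ) (j : ℕ) :
    bitLength (w.getD j 0) ≤ wordSize w := by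
  rw [List.getD_eq_getElem?_getD]
  rcases lt_or_ge j w.length with h | h
  · have := bitLength_le_wordSize (List.getElem_mem h)
    simp only [List.getElem?_eq_getElem h, Option.getD_some]
    omega
  · simp [List.getElem?_eq_none h, bitLength]

theorem length_le_wordSize (w : List ℤ) : w.length ≤ wordSize w := by
  simp [wordSize]

/-- The first index at which `f` is minimal among `0, …, b - 1`. -/
def minIndex (f : ℕ → ℤ) : ℕ → ℕ
  | 0 => 0
  | j + 1 => if f j < f (minIndex f j) then j else minIndex f j

theorem minIndex_le (f : ℕ → ℤ) (b : ℕ) : minIndex f b ≤ b := by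
  induction b with
  | zero => rfl
  | succ b ih => rw [minIndex]; split_ifs <;> omega

theorem minIndex_lt (f : ℕ → ℤ) {b : ℕ} (hb : 0 < b) : minIndex f b < b := by
  obtain ⟨b, rfl⟩ := Nat.exists_eq_succ_of_ne_zero hb.ne'
  have := minIndex_le f b
  rw [minIndex]
  split_ifs <;> omega

theorem apply_minIndex_le (f : ℕ → ℤ) {b j : ℕ} (hj : j < b) : f (minIndex f b) ≤ f j := by
  induction b with
  | zero => omega
  | succ b ih =>
    rw [minIndex]
    rcases Nat.lt_succ_iff_lt_or_eq.1 hj with h | rfl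
    · have := ih h
      split_ifs <;> linarith
    · split_ifs <;> linarith

theorem minIndex_congr {f g : ℕ → ℤ} (h : ∀ j, f j = g j) (b : ℕ) :
    minIndex f b = minIndex g b := by
  rw [funext h]

namespace Ctx

variable {Γ Δ : Type} {C : Ctx Γ}

/-- A fold whose accumulator is the position of the minimum so far. Each step evaluates `f` at the
loop index and at the accumulator, hence the hypothesis for every small index in every refinement.
-/
theorem SmallNat.minIndex {b : Γ → ℕ} (hb : C.SmallNat b) (f : Γ → ℕ → ℤ)
    (hf : ∀ (Δ : Type) (C' : Ctx Δ) (π : Δ → Γ) (i : Δ → ℕ), C'.Refines C π → C'.SmallNat i →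
      C'.PolyTime fun δ => f (π δ) (i δ)) :
    C.SmallNat fun γ => minIndex (f γ) (b γ) := by
  refine ⟨.fold hb (fun γ j => (RAM.minIndex (f γ) j : ℤ)) (.const 0) b hb.2 ?_ ?_,
    hb.2.mono fun γ _ _ => minIndex_le _ _⟩
  · intro γ s _ j hj
    exact (bitLength_natCast_le _).trans ((minIndex_le _ _).trans hj)
  · intro d h
    have hr := (refines_push (C := C.ext b d h)
      (fun p => (RAM.minIndex (f p.1) p.2 : ℤ)) (d + 1) le_rfl).trans (refines_ext b d h)
    have hj : ((C.ext b d h).push (fun p => (RAM.minIndex (f p.1) p.2 : ℤ)) (d + 1)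
        le_rfl).SmallNat fun p => p.2 := (SmallNat.index hb.2 d h).comap (refines_push _ _ _)
    have hm : ((C.ext b d h).push (fun p => (RAM.minIndex (f p.1) p.2 : ℤ)) (d + 1)
        le_rfl).SmallNat fun p => RAM.minIndex (f p.1) p.2 := by
      have hp := hj.2.mono (f := fun p => RAM.minIndex (f p.1) p.2)
        fun p _ _ => minIndex_le _ _
      exact ⟨.var (d + 1) (hp.mono fun p _ _ => bitLength_natCast_le _) fun p s hs => hs.2, hp⟩
    refine ((hf _ _ _ _ hr hj).ite_lt (hf _ _ _ _ hr hm) hj.1 hm.1).congr fun p _ _ => ?_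
    simp only [RAM.minIndex, Function.comp, id]
    split_ifs <;> rfl

/-- The configurations hold the word `word γ` as their input. -/
structure Reads (C : Ctx Γ) (word : Γ → List ℤ) : Prop where
  size : ∀ γ, wordSize (word γ) ≤ C.size γ
  length : ∀ γ s, C.rel γ s → s.var 0 = (word γ).length
  cell : ∀ γ s, C.rel γ s → ∀ j : ℕ, s.arr 0 j = (word γ).getD j 0

variable {word : Γ → List ℤ}

theorem Reads.comap (h : C.Reads word) {C' : Ctx Δ} {π : Δ → Γ} (hr : C'.Refines C π) :
    C'.Reads fun δ => word (π δ) :=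
  ⟨fun δ => by rw [hr.size]; exact h.size _, fun δ s hs => h.length _ s (hr.rel δ s hs),
    fun δ s hs => h.cell _ s (hr.rel δ s hs)⟩

theorem Reads.ext (h : C.Reads word) (b : Γ → ℕ) (d : ℕ) (hd : C.depth ≤ d) :
    (C.ext b d hd).Reads fun p => word p.1 := h.comap (refines_ext b d hd)

theorem Reads.polyTime_getD (h : C.Reads word) {i : Γ → ℕ} (hi : C.SmallNat i) :
    C.PolyTime fun γ => (word γ).getD (i γ) 0 :=
  .load 0 hi.1 (polyBounded_size.mono fun γ _ _ =>
    (bitLength_getD_le_wordSize _ _).trans (h.size γ)) fun γ s hs => h.cell γ s hs _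

theorem Reads.smallNat_length (h : C.Reads word) : C.SmallNat fun γ => (word γ).length := by
  have hp : C.PolyBounded fun γ => (word γ).length :=
    polyBounded_size.mono fun γ _ _ => (length_le_wordSize _).trans (h.size γ)
  exact ⟨.var 0 (hp.mono fun γ _ _ => bitLength_natCast_le _) h.length, hp⟩

theorem SmallNat.ext {b : Γ → ℕ} (hb : C.SmallNat b) (c : Γ → ℕ) (d : ℕ) (h : C.depth ≤ d) :
    (C.ext c d h).SmallNat fun p => b p.1 := hb.comap (refines_ext c d h)

end Ctx

end RAM

/-! ### The algorithm, as a function of the input word -/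

namespace PolymatrixGame

open RAM Finset

namespace Word

/-- Cell `j`, cut off to the range from `0` to the length of the word. -/
def clip (w : List ℤ) (j : ℕ) : ℕ := (min (w.getD j 0) w.length).toNat

/-- Clipping makes this a polynomially bounded loop bound for every word; on encodings it changes
nothing (`players_encode`, `actions_encode`). -/
def players (w : List ℤ) : ℕ := clip w 2

def actions (w : List ℤ) (k : ℕ) : ℕ := clip w (3 + k)

/-- The number of matrix entries in front of the entry `(i, j)` of block `(k, l)`. -/
def entryIndex (w : List ℤ) (k l i j : ℕ) : ℕ :=
  ∑ k' ∈ range k, ∑ l' ∈ range (players w), actions w k' * actions w l' +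
    (∑ l' ∈ range l, actions w k * actions w l' + (i * actions w l + j))

/-- The common denominator of all payoffs. -/
def scale (w : List ℤ) : ℤ :=
  ∏ r ∈ range (entryIndex w (players w) 0 0 0), w.getD (3 + players w + 2 * r + 1) 0

/-- Payoffs, multiplied by the common denominator. -/
def entry (w : List ℤ) (k l i j : ℕ) : ℤ :=
  w.getD (3 + players w + 2 * entryIndex w k l i j) 0 *
    (scale w / w.getD (3 + players w + 2 * entryIndex w k l i j + 1) 0)

/-- The advantage of action `i` over action `0` of player `k` against action `j` of player `l`. -/
def gap (w : List ℤ) (k i l j : ℕ) : ℤ := entry w k l i j - entry w k l 0 j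

/-- The cumulated advantage of action `i` of player `k` in the first `t` rounds, when player `l`
uses the action `H (t' * players + l)` in round `t'`. -/
def drift (w : List ℤ) (H : ℕ → ℕ) (t k i : ℕ) : ℤ :=
  ∑ t' ∈ range t, ∑ l ∈ range (players w), gap w k i l (H (t' * players w + l))

/-- The inner product of the cumulated advantages with the effect of action `j` of player `l`. -/
def score (w : List ℤ) (H : ℕ → ℕ) (t l j : ℕ) : ℤ :=
  ∑ k ∈ range (players w), ∑ i ∈ range (actions w k), drift w H t k i * gap w k i l j

/-- The index `q = t * players w + l` stands for player `l` in round `t`. -/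
def reply (w : List ℤ) (H : ℕ → ℕ) (q : ℕ) : ℕ :=
  minIndex (score w H (q / players w) (q % players w)) (actions w (q % players w))

/-- After `q` steps the cells below `q` are final and the others are still zero. -/
def history (w : List ℤ) : ℕ → ℕ → ℕ
  | 0 => 0
  | q + 1 => Function.update (history w q) q (reply w (history w q) q)

/-- The actions chosen by the algorithm. -/
def play (w : List ℤ) (q : ℕ) : ℕ := history w (q + 1) q

/-- With `ε` in the first two cells this is `⌊4 * L / ε ^ 2⌋ + 1`, where the word length `L` serves
as an upper bound for the total number of actions. -/
def rounds (w : List ℤ) : ℕ :=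
  (4 * w.length * (w.getD 1 0 * w.getD 1 0) / (w.getD 0 0 * w.getD 0 0)).toNat + 1

/-- How often player `k` uses action `i`. -/
def count (w : List ℤ) (k i : ℕ) : ℕ :=
  ∑ t ∈ range (rounds w), if play w (t * players w + k) = i then 1 else 0

def offset (w : List ℤ) (k : ℕ) : ℕ := ∑ k' ∈ range k, actions w k'

/-- At most one summand differs from zero. The double sum locates the cell by operations already
known to be polynomial. -/
def output (w : List ℤ) (r : ℕ) : ℕ :=
  ∑ k ∈ range (players w), ∑ i ∈ range (actions w k),
    if r = 2 * (offset w k + i) then count w k i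
    else if r = 2 * (offset w k + i) + 1 then rounds w else 0

theorem clip_le (w : List ℤ) (j : ℕ) : clip w j ≤ w.length := by
  simp only [clip]
  omega

theorem history_eq_play (w : List ℤ) {q n : ℕ} (h : q < n) : history w n q = play w q := by
  induction n with
  | zero => omega
  | succ n ih =>
    rcases Nat.lt_succ_iff_lt_or_eq.1 h with h | rfl
    · rw [history, Function.update_of_ne h.ne, ih h]
    · rfl

theorem drift_congr (w : List ℤ) {H H' : ℕ → ℕ} {t : ℕ} (h : ∀ q < t * players w, H q = H' q)
    (k i : ℕ) : drift w H t k i = drift w H' t k i := by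
  refine sum_congr rfl fun t' ht' => sum_congr rfl fun l hl => ?_
  rw [mem_range] at ht' hl
  rw [h]
  calc t' * players w + l < t' * players w + players w := by omega
    _ = (t' + 1) * players w := by ring
    _ ≤ t * players w := Nat.mul_le_mul_right _ ht'

/-- A reply consults completed rounds only, that is cells below `q / players w * players w ≤ q`,
where the history has its final values. -/
theorem play_eq_reply (w : List ℤ) (q : ℕ) : play w q = reply w (play w) q := by
  rw [play, history, Function.update_self, reply, reply]
  refine minIndex_congr (fun j => ?_) _
  refine sum_congr rfl fun k _ => sum_congr rfl fun i _ => ?_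
  rw [drift_congr w fun q' hq' => history_eq_play w (hq'.trans_le (Nat.div_mul_le_self _ _))]

theorem play_le (w : List ℤ) (q : ℕ) : play w q ≤ w.length := by
  rw [play_eq_reply]
  exact (minIndex_le _ _).trans (clip_le _ _)

theorem count_le (w : List ℤ) (k i : ℕ) : count w k i ≤ rounds w :=
  (sum_le_card_nsmul _ _ 1 fun t _ => by split_ifs <;> simp).trans (by simp)

end Word

/-! ### Polynomial running time of the algorithm -/

open Word Ctx

variable {Γ : Type} {C : Ctx Γ} {word : Γ → List ℤ}

theorem smallNat_clip (h : C.Reads word) {j : Γ → ℕ} (hj : C.SmallNat j) :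
    C.SmallNat fun γ => clip (word γ) (j γ) := by
  refine ⟨((PolyTime.const 0).ite_lt (h.polyTime_getD hj) ((h.polyTime_getD hj).ite_lt
    h.smallNat_length.1 (h.polyTime_getD hj) h.smallNat_length.1) (.const 0)).congr
      fun γ _ _ => ?_, h.smallNat_length.2.mono fun γ _ _ => clip_le _ _⟩
  simp only [clip]
  split_ifs <;> omega

theorem smallNat_players (h : C.Reads word) : C.SmallNat fun γ => players (word γ) :=
  smallNat_clip h (.const 2)

theorem smallNat_actions (h : C.Reads word) {k : Γ → ℕ} (hk : C.SmallNat k) :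
    C.SmallNat fun γ => actions (word γ) (k γ) :=
  smallNat_clip h ((SmallNat.const 3).add hk)

theorem smallNat_entryIndex (h : C.Reads word) {k l i j : Γ → ℕ} (hk : C.SmallNat k)
    (hl : C.SmallNat l) (hi : C.SmallNat i) (hj : C.SmallNat j) :
    C.SmallNat fun γ => entryIndex (word γ) (k γ) (l γ) (i γ) (j γ) := by
  unfold entryIndex
  refine (SmallNat.sum hk fun d hd => SmallNat.sum ((smallNat_players h).ext _ d hd)
    fun d' hd' => ?_).add ((SmallNat.sum hl fun d hd => ?_).add
      ((hi.mul (smallNat_actions h hl)).add hj))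
  · have h' := (h.ext _ d hd).ext (fun p => players (word p.1)) d' hd'
    exact (smallNat_actions h' ((SmallNat.index hk.2 d hd).ext _ d' hd')).mul
      (smallNat_actions h' (SmallNat.index ((smallNat_players h).ext k d hd).2 d' hd'))
  · have h' := h.ext l d hd
    exact (smallNat_actions h' (hk.ext l d hd)).mul
      (smallNat_actions h' (SmallNat.index hl.2 d hd))

theorem polyTime_scale (h : C.Reads word) : C.PolyTime fun γ => scale (word γ) := by
  have hb := smallNat_entryIndex h (smallNat_players h) (.const 0) (.const 0) (.const 0)
  refine PolyTime.prod hb fun d hd => ?_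
  have h' := h.ext (fun γ => entryIndex (word γ) (players (word γ)) 0 0 0) d hd
  exact h'.polyTime_getD ((((SmallNat.const 3).add (smallNat_players h')).add
    ((SmallNat.const 2).mul (SmallNat.index hb.2 d hd))).add (.const 1))

theorem polyTime_entry (h : C.Reads word) {k l i j : Γ → ℕ} (hk : C.SmallNat k)
    (hl : C.SmallNat l) (hi : C.SmallNat i) (hj : C.SmallNat j) :
    C.PolyTime fun γ => entry (word γ) (k γ) (l γ) (i γ) (j γ) := by
  have hp := ((SmallNat.const 3).add (smallNat_players h)).add
    ((SmallNat.const 2).mul (smallNat_entryIndex h hk hl hi hj))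
  exact (h.polyTime_getD hp).mul ((polyTime_scale h).div (h.polyTime_getD (hp.add (.const 1))))

theorem polyTime_gap (h : C.Reads word) {k i l j : Γ → ℕ} (hk : C.SmallNat k)
    (hi : C.SmallNat i) (hl : C.SmallNat l) (hj : C.SmallNat j) :
    C.PolyTime fun γ => gap (word γ) (k γ) (i γ) (l γ) (j γ) :=
  (polyTime_entry h hk hl hi hj).sub (polyTime_entry h hk hl (.const 0) hj)

/-- The recursion is never unfolded: past actions are looked up in array `1`. -/
theorem smallNat_play (h : C.Reads word) {q : Γ → ℕ} (hq : C.SmallNat q)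
    (hH : ∀ γ s, C.rel γ s → s.arr 1 (q γ) = play (word γ) (q γ)) :
    C.SmallNat fun γ => play (word γ) (q γ) := by
  have hp : C.PolyBounded fun γ => play (word γ) (q γ) :=
    h.smallNat_length.2.mono fun γ _ _ => play_le _ _
  exact ⟨.load 1 hq.1 (hp.mono fun γ _ _ => bitLength_natCast_le _) hH, hp⟩

/-- The actions chosen in the first `t γ` rounds are stored in array `1`. -/
def Recorded (C : Ctx Γ) (word : Γ → List ℤ) (t : Γ → ℕ) : Prop :=
  ∀ γ s, C.rel γ s → ∀ q < t γ * players (word γ), s.arr 1 q = play (word γ) q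

theorem Recorded.comap {t : Γ → ℕ} (h : Recorded C word t) {Δ : Type} {C' : Ctx Δ} {π : Δ → Γ}
    (hr : C'.Refines C π) : Recorded C' (fun δ => word (π δ)) fun δ => t (π δ) :=
  fun δ s hs => h _ s (hr.rel δ s hs)

theorem mul_add_lt_mul {t t' l n : ℕ} (ht : t' < t) (hl : l < n) : t' * n + l < t * n :=
  calc t' * n + l < t' * n + n := by omega
    _ = (t' + 1) * n := by ring
    _ ≤ t * n := Nat.mul_le_mul_right _ ht

theorem polyTime_drift (h : C.Reads word) {t k i : Γ → ℕ} (hH : Recorded C word t)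
    (ht : C.SmallNat t) (hk : C.SmallNat k) (hi : C.SmallNat i) :
    C.PolyTime fun γ => drift (word γ) (play (word γ)) (t γ) (k γ) (i γ) := by
  refine PolyTime.sum ht fun d hd => PolyTime.sum ((smallNat_players h).ext _ d hd)
    fun d' hd' => ?_
  have h' := (h.ext t d hd).ext (fun p => players (word p.1)) d' hd'
  have hl := SmallNat.index ((smallNat_players h).ext t d hd).2 d' hd'
  refine polyTime_gap h' ((hk.ext _ d hd).ext _ d' hd') ((hi.ext _ d hd).ext _ d' hd') hl
    (smallNat_play h' ((((SmallNat.index ht.2 d hd).ext _ d' hd').mul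
      (smallNat_players h')).add hl) fun p s hs => ?_)
  exact hH _ s hs.1.1 _ (mul_add_lt_mul hs.1.2.1 hs.2.1)

theorem polyTime_score (h : C.Reads word) {t l j : Γ → ℕ} (hH : Recorded C word t)
    (ht : C.SmallNat t) (hl : C.SmallNat l) (hj : C.SmallNat j) :
    C.PolyTime fun γ => score (word γ) (play (word γ)) (t γ) (l γ) (j γ) := by
  refine PolyTime.sum (smallNat_players h) fun d hd => ?_
  have h₁ := h.ext (fun γ => players (word γ)) d hd
  have hk := SmallNat.index (smallNat_players h).2 d hd
  refine PolyTime.sum (smallNat_actions h₁ hk) fun d' hd' => ?_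
  have h₂ := h₁.ext (fun p => actions (word p.1) p.2) d' hd'
  have hi := SmallNat.index (smallNat_actions h₁ hk).2 d' hd'
  exact (polyTime_drift h₂ (hH.comap ((refines_ext _ d' hd').trans (refines_ext _ d hd)))
    ((ht.ext _ d hd).ext _ d' hd') (hk.ext _ d' hd') hi).mul
      (polyTime_gap h₂ (hk.ext _ d' hd') hi ((hl.ext _ d hd).ext _ d' hd')
        ((hj.ext _ d hd).ext _ d' hd'))

theorem smallNat_reply (h : C.Reads word) {q : Γ → ℕ} (hq : C.SmallNat q)
    (hH : Recorded C word fun γ => q γ / players (word γ)) :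
    C.SmallNat fun γ => reply (word γ) (play (word γ)) (q γ) := by
  have hn := smallNat_players h
  exact SmallNat.minIndex (smallNat_actions h (hq.mod hn)) _ fun Δ C' π i hr hi =>
    polyTime_score (h.comap hr) (hH.comap hr) ((hq.div hn).comap hr) ((hq.mod hn).comap hr) hi

/-- The number of rounds is of order `1 / ε ^ 2`, which the word size alone does not bound; `hT` is
where the dependence on `1 / ε` enters. -/
theorem smallNat_rounds (h : C.Reads word) (hT : C.PolyBounded fun γ => rounds (word γ)) :
    C.SmallNat fun γ => rounds (word γ) := by
  have h0 := h.polyTime_getD (SmallNat.const 0)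
  have h1 := h.polyTime_getD (SmallNat.const 1)
  refine ⟨(((((PolyTime.const 4).mul h.smallNat_length.1).mul (h1.mul h1)).div
    (h0.mul h0)).add (.const 1)).congr fun γ _ _ => ?_, hT⟩
  simp only [rounds, Nat.cast_succ]
  rw [Int.toNat_of_nonneg]
  exact Int.ediv_nonneg (mul_nonneg (by positivity) (mul_self_nonneg _)) (mul_self_nonneg _)

theorem smallNat_count (h : C.Reads word) (hT : C.PolyBounded fun γ => rounds (word γ))
    (hH : Recorded C word fun γ => rounds (word γ)) {k i : Γ → ℕ} (hk : C.SmallNat k)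
    (hi : C.SmallNat i) (hkn : ∀ γ s, C.rel γ s → k γ < players (word γ)) :
    C.SmallNat fun γ => count (word γ) (k γ) (i γ) := by
  have ht := smallNat_rounds h hT
  refine ⟨?_, hT.mono fun γ _ _ => count_le _ _ _⟩
  simp only [count, Nat.cast_sum, Nat.cast_ite]
  refine PolyTime.sum ht fun d hd => ?_
  have h' := h.ext (fun γ => rounds (word γ)) d hd
  refine PolyTime.ite_eq (smallNat_play h' (((SmallNat.index ht.2 d hd).mul
    (smallNat_players h')).add (hk.ext _ d hd)) fun p s hs => ?_).1 (hi.ext _ d hd).1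
      (.const _) (.const _)
  exact hH _ s hs.1 _ (mul_add_lt_mul hs.2.1 (hkn _ s hs.1))

theorem smallNat_offset (h : C.Reads word) {k : Γ → ℕ} (hk : C.SmallNat k) :
    C.SmallNat fun γ => offset (word γ) (k γ) :=
  SmallNat.sum hk fun d hd => smallNat_actions (h.ext k d hd) (SmallNat.index hk.2 d hd)

theorem polyTime_output (h : C.Reads word) (hT : C.PolyBounded fun γ => rounds (word γ))
    (hH : Recorded C word fun γ => rounds (word γ)) {r : Γ → ℕ} (hr : C.SmallNat r) :
    C.PolyTime fun γ => (output (word γ) (r γ) : ℤ) := by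
  simp only [output, Nat.cast_sum, Nat.cast_ite]
  refine PolyTime.sum (smallNat_players h) fun d hd => ?_
  have h₁ := h.ext (fun γ => players (word γ)) d hd
  have hk := SmallNat.index (smallNat_players h).2 d hd
  refine PolyTime.sum (smallNat_actions h₁ hk) fun d' hd' => ?_
  have h₂ := h₁.ext (fun p => actions (word p.1) p.2) d' hd'
  have hi := SmallNat.index (smallNat_actions h₁ hk).2 d' hd'
  have href := (refines_ext (fun p : Γ × ℕ => actions (word p.1) p.2) d' hd').trans
    (refines_ext _ d hd)
  have hpos := (SmallNat.const 2).mul ((smallNat_offset h₂ (hk.ext _ d' hd')).add hi)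
  have hr' := (hr.ext _ d hd).ext (fun p => actions (word p.1) p.2) d' hd'
  exact PolyTime.ite_eq hr'.1 hpos.1
    (smallNat_count h₂ (hT.comap href) (hH.comap href) (hk.ext _ d' hd') hi
      fun p s hs => hs.1.2.1).1
    (PolyTime.ite_eq hr'.1 (hpos.add (.const 1)).1 (smallNat_rounds h₂ (hT.comap href)).1
      (.const _))

end PolymatrixGame

/-! ### Assembling the program -/

namespace RAM.Ctx

variable {Γ : Type} {C : Ctx Γ}

theorem Achieves.of_imp {C' : Ctx Γ} (hs : C'.size = C.size)
    (h : ∀ γ s, C.rel γ s → C'.rel γ s) : C.Achieves C' :=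
  ⟨hs, .skip, fun _ => 1, polyBounded_const 1, fun γ s hs => ⟨s, 1, .skip s, le_rfl, h γ s hs⟩⟩

theorem PolyTime.achieves_push {F : Γ → ℤ} (hF : C.PolyTime F) :
    C.Achieves (C.push F C.depth le_rfl) := by
  obtain ⟨c, τ, hτ, hc⟩ := hF.2 C.depth le_rfl
  refine ⟨rfl, c, τ, hτ, fun γ s hs => ?_⟩
  obtain ⟨s', t, hx, ht, ha, hv, hd⟩ := hc γ s hs
  exact ⟨s', t, hx, ht, C.stable γ s s' hs ha hv, hd⟩

end RAM.Ctx

namespace PolymatrixGame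

open RAM Finset Word Ctx

/-- Array `1` receives the plays and array `2` the output. The input in array `0` is needed until
then; only afterwards is array `2` copied over it, with the output length kept in register `1`. -/
theorem exists_program {Γ : Type} (word : Γ → List ℤ) (size : Γ → ℕ)
    (hsize : ∀ γ, wordSize (word γ) ≤ size γ)
    (hT : ∃ k, ∀ γ, rounds (word γ) ≤ (size γ + 2) ^ k) :
    ∃ (c : Program) (k : ℕ), ∀ γ, ∃ s t, Exec c (initial (word γ)) s t ∧
      t ≤ (size γ + 2) ^ k ∧ s.var 0 = (2 * offset (word γ) (players (word γ)) : ℕ) ∧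
      ∀ r < 2 * offset (word γ) (players (word γ)), s.arr 0 r = output (word γ) r := by
  let C₀ : Ctx Γ :=
    { size := size
      depth := 1
      rel := fun γ s => s.var 0 = (word γ).length ∧ ∀ j : ℕ, s.arr 0 j = (word γ).getD j 0
      stable := fun γ s s' hs ha hv => by rw [hv 0 one_pos, ha]; exact hs }
  have hTC : ∀ C : Ctx Γ, C.size = size → C.PolyBounded fun γ => rounds (word γ) :=
    fun C hC => hT.imp fun k hk γ s _ => by rw [hC]; exact hk γ
  have h₀ : C₀.Reads word := ⟨hsize, fun γ s hs => hs.1, fun γ s hs => hs.2⟩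
  have hupd : ∀ (a : ℕ) (γ : Γ) (s : State) (x : ℤ → ℤ), a ≠ 0 → C₀.rel γ s →
      C₀.rel γ { s with arr := Function.update s.arr a x } := fun a γ s x ha hs =>
    ⟨hs.1, fun j => by
      show Function.update s.arr a x 0 j = _
      rw [Function.update_of_ne ha.symm]; exact hs.2 j⟩
  have hb₁ := (smallNat_rounds h₀ (hTC _ rfl)).mul (smallNat_players h₀)
  have ach₁ := achieves_fill hb₁ 1 (fun γ q => (play (word γ) q : ℤ))
    (fun γ s x hs => hupd 1 γ s x one_ne_zero hs) (by
      intro d hd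
      have hr := refines_withArr (C := C₀.ext (fun γ => rounds (word γ) * players (word γ)) d hd)
        fun p A => ∀ r < p.2, A 1 r = (play (word p.1) r : ℤ)
      have hq := (SmallNat.index hb₁.2 d hd).comap hr
      refine (smallNat_reply (h₀.comap (hr.trans (refines_ext _ d hd))) hq
        fun p s hs q hq => ?_).1.congr fun p s hs => ?_
      · exact hs.2 q (hq.trans_le (Nat.div_mul_le_self _ _))
      · exact congrArg Nat.cast (play_eq_reply _ _))
  set C₁ := C₀.withArr fun γ A =>
    ∀ r < rounds (word γ) * players (word γ), A 1 r = (play (word γ) r : ℤ)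
  have h₁ : C₁.Reads word := h₀.comap (refines_withArr _)
  have hH₁ : Recorded C₁ word fun γ => rounds (word γ) := fun γ s hs => hs.2
  have hb₂ : C₁.SmallNat fun γ => 2 * offset (word γ) (players (word γ)) :=
    (SmallNat.const 2).mul (smallNat_offset h₁ (smallNat_players h₁))
  have ach₂ := achieves_fill hb₂ 2 (fun γ r => (output (word γ) r : ℤ))
    (fun γ s x hs => ⟨hupd 2 γ s x two_ne_zero hs.1, fun r hr => by
      show Function.update s.arr 2 x 1 r = _
      rw [Function.update_of_ne (by norm_num)]; exact hs.2 r hr⟩) (by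
      intro d hd
      have hr := (refines_withArr
        (C := C₁.ext (fun γ => 2 * offset (word γ) (players (word γ))) d hd)
        fun p A => ∀ r < p.2, A 2 r = (output (word p.1) r : ℤ)).trans (refines_ext _ d hd)
      exact polyTime_output (h₁.comap hr) ((hTC C₁ rfl).comap hr) (hH₁.comap hr)
        ((SmallNat.index hb₂.2 d hd).comap (refines_withArr _)))
  set C₂ := C₁.withArr fun γ A =>
    ∀ r < 2 * offset (word γ) (players (word γ)), A 2 r = (output (word γ) r : ℤ)
  have hb₃ : C₂.SmallNat fun γ => 2 * offset (word γ) (players (word γ)) :=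
    hb₂.comap (refines_withArr _)
  -- The bit bound on the output is derived while the input is intact, for use in the copying phase.
  obtain ⟨k₃, hk₃⟩ := (polyTime_output (h₁.ext _ 1 le_rfl) ((hTC C₁ rfl).comap
    (refines_ext _ 1 le_rfl)) (hH₁.comap (refines_ext _ 1 le_rfl))
      (SmallNat.index hb₂.2 1 le_rfl)).1
  -- This context forgets the input. It remembers that some configuration of `C₁` exists, so that
  -- bounds obtained in `C₁` remain applicable.
  let C₃ : Ctx Γ :=
    { size := size
      depth := 2
      rel := fun γ s => (∃ s', C₁.rel γ s') ∧
        s.var 1 = (2 * offset (word γ) (players (word γ)) : ℕ) ∧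
        ∀ r < 2 * offset (word γ) (players (word γ)), s.arr 2 r = (output (word γ) r : ℤ)
      stable := fun γ s s' hs ha hv => by rw [hv 1 one_lt_two, ha]; exact hs }
  have ach₃ : C₂.Achieves C₃ := hb₃.1.achieves_push.trans
    (.of_imp rfl fun γ s hs => ⟨⟨s, hs.1.1⟩, hs.2, hs.1.2⟩)
  have hb₄ : C₃.SmallNat fun γ => 2 * offset (word γ) (players (word γ)) := by
    obtain ⟨k, hk⟩ := hb₂.2
    have hp : C₃.PolyBounded fun γ => 2 * offset (word γ) (players (word γ)) :=
      ⟨k, fun γ s ⟨⟨s', hs'⟩, _⟩ => hk γ s' hs'⟩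
    exact ⟨.var 1 (hp.mono fun γ _ _ => bitLength_natCast_le _) fun γ s hs => hs.2.1, hp⟩
  have ach₄ := achieves_fill hb₄ 0 (fun γ r => (output (word γ) r : ℤ))
    (fun γ s x hs => ⟨hs.1, hs.2.1, fun r hr => by
      show Function.update s.arr 0 x 2 r = _
      rw [Function.update_of_ne (by norm_num)]; exact hs.2.2 r hr⟩) (by
      intro d hd
      refine .load 2 (((SmallNat.index hb₄.2 d hd).comap (refines_withArr _)).1)
        ⟨k₃, fun p s hs => ?_⟩ fun p s hs => hs.1.1.2.2 _ hs.1.2.1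
      obtain ⟨⟨⟨⟨s', hs'⟩, -⟩, hp, -⟩, -⟩ := hs
      exact hk₃ p { s' with var := Function.update s'.var 1 p.2 }
        ⟨C₁.stable p.1 s' _ hs' rfl fun l hl => Function.update_of_ne hl.ne _ _, hp,
          by simp⟩)
  obtain ⟨-, c, τ, hτ, hc⟩ := ((ach₁.trans ach₂).trans ach₃).trans ach₄
  have hlen : C₀.PolyBounded fun γ => 2 * offset (word γ) (players (word γ)) :=
    (SmallNat.const 2).mul (smallNat_offset h₀ (smallNat_players h₀)) |>.2
  obtain ⟨k, hk⟩ := hτ.add ((polyBounded_const 2).add hlen)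
  refine ⟨.seq c (.assign 0 (.var 1)), k, fun γ => ?_⟩
  have hrel : C₀.rel γ (initial (word γ)) := ⟨by simp [initial], fun j => by simp [initial]⟩
  obtain ⟨s, t, hx, ht, ⟨-, hlen', -⟩, hout⟩ := hc γ _ hrel
  obtain ⟨s', hx', ha, -, hv⟩ := exec_assign (i := 0) (e := .var 1) s
  refine ⟨s', _, hx.seq hx', ?_, by rw [hv]; exact hlen', by rw [ha]; exact hout⟩
  refine le_trans ?_ (hk γ _ hrel)
  have := bitLength_natCast_le (2 * offset (word γ) (players (word γ)))
  simp only [Expr.cost, hlen']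
  omega

end PolymatrixGame

/-! ### Expected payoffs -/

namespace PolymatrixGame

open Finset

variable (G : PolymatrixGame)

/-- The expected payoff of player `k` for the pure strategy `i` against `x`. -/
noncomputable def actionPayoff (x : G.Profile) (k : Fin G.numPlayers) (i : Fin (G.numActions k)) :
    ℝ :=
  ∑ l, ∑ j, (G.payoff k l i j : ℝ) * x l j

variable {G}

/-- Replacing `x k` and `x l` by their restrictions to `i` and `j` absorbs the condition, and the
sum over joint actions factorizes; all other factors are `1`. -/
theorem sum_ite_prod_eq {x : G.Profile} (hx : ∀ k, ∑ i, x k i = 1) {k l : Fin G.numPlayers}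
    (hkl : k ≠ l) (i : Fin (G.numActions k)) (j : Fin (G.numActions l)) :
    ∑ a : G.JointAction, (if a k = i ∧ a l = j then ∏ p, x p (a p) else 0) = x k i * x l j := by
  let y : G.Profile := Function.update (Function.update x k fun b => if b = i then x k b else 0) l
    fun b => if b = j then x l b else 0
  have hyk : y k = fun b => if b = i then x k b else 0 := by simp [y, hkl]
  have hyl : y l = fun b => if b = j then x l b else 0 := by simp [y]
  have hyp : ∀ p, p ≠ k ∧ p ≠ l → y p = x p := fun p hp => by simp [y, hp.1, hp.2]
  have h1 : ∀ a : G.JointAction,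
      (if a k = i ∧ a l = j then ∏ p, x p (a p) else 0) = ∏ p, y p (a p) := by
    intro a
    split_ifs with h
    · refine prod_congr rfl fun p _ => ?_
      by_cases hk : p = k
      · subst hk; simp [hyk, h.1]
      by_cases hl : p = l
      · subst hl; simp [hyl, h.2]
      rw [hyp p ⟨hk, hl⟩]
    · rcases not_and_or.1 h with h | h
      · exact (prod_eq_zero (mem_univ k) (by simp [hyk, h])).symm
      · exact (prod_eq_zero (mem_univ l) (by simp [hyl, h])).symm
  rw [sum_congr rfl fun a _ => h1 a]
  have h2 := (prod_univ_sum (fun p => (univ : Finset (Fin (G.numActions p)))) y).symm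
  rw [Fintype.piFinset_univ] at h2
  rw [h2, Fintype.prod_eq_mul k l hkl fun p hp => by rw [hyp p hp, hx]]
  simp [hyk, hyl]

theorem sum_mul_prod_eq {x : G.Profile} (hx : ∀ k, ∑ i, x k i = 1) {k l : Fin G.numPlayers}
    (hkl : k ≠ l) (F : Fin (G.numActions k) → Fin (G.numActions l) → ℝ) :
    ∑ a : G.JointAction, F (a k) (a l) * ∏ p, x p (a p) =
      ∑ i, x k i * ∑ j, F i j * x l j := by
  have h : ∀ a : G.JointAction, F (a k) (a l) * ∏ p, x p (a p) =
      ∑ i, ∑ j, F i j * (if a k = i ∧ a l = j then ∏ p, x p (a p) else 0) := by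
    intro a
    rw [sum_eq_single (a k) (fun i _ hi => by simp [hi.symm]) (by simp),
      sum_eq_single (a l) (fun j _ hj => by simp [hj.symm]) (by simp)]
    simp
  rw [sum_congr rfl fun a _ => h a, sum_comm]
  refine sum_congr rfl fun i _ => ?_
  rw [sum_comm, mul_sum]
  refine sum_congr rfl fun j _ => ?_
  rw [← mul_sum, sum_ite_prod_eq hx hkl]
  ring

theorem pureUtility_eq_sum (k : Fin G.numPlayers) (a : G.JointAction) :
    G.pureUtility k a = ∑ l, G.payoff k l (a k) (a l) := by
  rw [pureUtility, sum_erase]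
  simp [G.payoff_self]

theorem utility_eq_sum {x : G.Profile} (hx : ∀ k, ∑ i, x k i = 1) (k : Fin G.numPlayers) :
    G.utility k x = ∑ i, x k i * G.actionPayoff x k i := by
  simp only [utility, pureUtility_eq_sum, Rat.cast_sum, sum_mul, actionPayoff, mul_sum (s := univ)]
  rw [sum_comm]
  refine Eq.trans ?_ sum_comm
  refine sum_congr rfl fun l _ => ?_
  by_cases h : k = l
  · subst h; simp [G.payoff_self]
  · rw [sum_mul_prod_eq hx h fun i j => (G.payoff k l i j : ℝ)]
    simp only [mul_sum]

/-- The own strategy meets only the zero diagonal block. -/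
theorem actionPayoff_update (x : G.Profile) (k : Fin G.numPlayers)
    (z : Fin (G.numActions k) → ℝ) (i : Fin (G.numActions k)) :
    G.actionPayoff (Function.update x k z) k i = G.actionPayoff x k i := by
  refine sum_congr rfl fun l _ => ?_
  by_cases h : l = k
  · subst h; simp [G.payoff_self]
  · rw [Function.update_of_ne h]

theorem IsStrategy.update {x : G.Profile} (hx : G.IsStrategy x) {k : Fin G.numPlayers}
    {z : Fin (G.numActions k) → ℝ} (hz : z ∈ stdSimplex ℝ (Fin (G.numActions k))) :
    G.IsStrategy (Function.update x k z) := by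
  intro l
  by_cases h : l = k
  · subst h; simpa using hz
  · rw [Function.update_of_ne h]; exact hx l

theorem utility_update {x : G.Profile} (hx : G.IsStrategy x) {k : Fin G.numPlayers}
    {z : Fin (G.numActions k) → ℝ} (hz : z ∈ stdSimplex ℝ (Fin (G.numActions k))) :
    G.utility k (Function.update x k z) = ∑ i, z i * G.actionPayoff x k i := by
  rw [utility_eq_sum fun l => (hx.update hz l).2]
  simp [actionPayoff_update]

theorem numActions_pos {x : G.Profile} (hx : G.IsStrategy x) (k : Fin G.numPlayers) :
    0 < G.numActions k := by
  by_contra h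
  have : IsEmpty (Fin (G.numActions k)) := ⟨fun i => h i.pos⟩
  simpa using (hx k).2

/-- In an interior Nash equilibrium all pure strategies of a player have the same payoff. -/
theorem actionPayoff_eq_of_interior {x : G.Profile} (hx : G.IsApproxNash 0 x)
    (hpos : ∀ k i, 0 < x k i) (k : Fin G.numPlayers) (i i' : Fin (G.numActions k)) :
    G.actionPayoff x k i = G.actionPayoff x k i' := by
  have hle : ∀ i, G.actionPayoff x k i ≤ G.utility k x := by
    intro i
    have hz := single_mem_stdSimplex ℝ i
    have := hx.2 k _ hz
    rw [utility_update hx.1 hz] at this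
    simpa [Pi.single_apply] using this
  -- The nonnegative regrets average to zero under positive weights, so each of them vanishes.
  have hsum : ∑ i, x k i * (G.utility k x - G.actionPayoff x k i) = 0 := by
    simp only [mul_sub, sum_sub_distrib, ← sum_mul, (hx.1 k).2, one_mul]
    rw [← utility_eq_sum fun l => (hx.1 l).2, sub_self]
  have heq : ∀ i, G.actionPayoff x k i = G.utility k x := by
    intro i
    have := (sum_eq_zero_iff_of_nonneg fun i _ =>
      mul_nonneg (hpos k i).le (sub_nonneg.2 (hle i))).1 hsum i (mem_univ i)
    rcases mul_eq_zero.1 this with h | h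
    · exact absurd h (hpos k i).ne'
    · linarith
  rw [heq, heq]

/-- Every mixed strategy then earns within `ε / 2` of the reference action, so any two differ by at
most `ε`. -/
theorem isApproxNash_of_abs_le {x : G.Profile} (hx : G.IsStrategy x) {ε : ℝ}
    (o : G.JointAction)
    (h : ∀ k i, |G.actionPayoff x k i - G.actionPayoff x k (o k)| ≤ ε / 2) :
    G.IsApproxNash ε x := by
  refine ⟨hx, fun k z hz => ?_⟩
  rw [utility_update hx hz, utility_eq_sum fun l => (hx l).2]
  have key : ∀ y ∈ stdSimplex ℝ (Fin (G.numActions k)),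
      |∑ i, y i * G.actionPayoff x k i - G.actionPayoff x k (o k)| ≤ ε / 2 := by
    intro y hy
    have : ∑ i, y i * G.actionPayoff x k i - G.actionPayoff x k (o k) =
        ∑ i, y i * (G.actionPayoff x k i - G.actionPayoff x k (o k)) := by
      simp only [mul_sub, sum_sub_distrib, ← sum_mul, hy.2, one_mul]
    rw [this]
    calc |∑ i, y i * (G.actionPayoff x k i - G.actionPayoff x k (o k))|
        ≤ ∑ i, |y i * (G.actionPayoff x k i - G.actionPayoff x k (o k))| :=
          abs_sum_le_sum_abs _ _
      _ ≤ ∑ i, y i * (ε / 2) := sum_le_sum fun i _ => by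
          rw [abs_mul, abs_of_nonneg (hy.1 i)]
          exact mul_le_mul_of_nonneg_left (h k i) (hy.1 i)
      _ = ε / 2 := by rw [← sum_mul, hy.2, one_mul]
  have h1 := abs_le.1 (key z hz)
  have h2 := abs_le.1 (key (x k) (hx k))
  linarith

/-! ### Balancing the advantages of pure strategies -/

variable (G) in
/-- The advantage of action `i` over the reference action of player `k` against action `j` of
player `l`. -/
def advantage (o : G.JointAction) (k : Fin G.numPlayers) (i : Fin (G.numActions k))
    (l : Fin G.numPlayers) (j : Fin (G.numActions l)) : ℝ :=
  G.payoff k l i j - G.payoff k l (o k) j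

variable (G) in
/-- The advantages cumulated in the first `t` rounds of a sequence of joint actions. -/
def cumulated (o : G.JointAction) (act : ℕ → G.JointAction) (t : ℕ) (k : Fin G.numPlayers)
    (i : Fin (G.numActions k)) : ℝ :=
  ∑ t' ∈ range t, ∑ l, G.advantage o k i l (act t' l)

variable (G) in
/-- The empirical frequencies of the first `T` rounds. -/
noncomputable def frequency (act : ℕ → G.JointAction) (T : ℕ) : G.Profile := fun k i =>
  (∑ t ∈ range T, if act t k = i then 1 else 0 : ℕ) / (T : ℝ)

theorem sum_advantage_mul (o : G.JointAction) (x : G.Profile) (k : Fin G.numPlayers)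
    (i : Fin (G.numActions k)) :
    ∑ l, ∑ j, G.advantage o k i l j * x l j =
      G.actionPayoff x k i - G.actionPayoff x k (o k) := by
  simp only [advantage, actionPayoff, sub_mul, sum_sub_distrib]

/-- The sum is a difference of two normalized utilities, at two deviations of player `k` from `a`.
Single advantages need not be bounded by `1`. -/
theorem abs_sum_advantage_le (hG : G.UnitPayoffs) (o a : G.JointAction) (k : Fin G.numPlayers)
    (i : Fin (G.numActions k)) : |∑ l, G.advantage o k i l (a l)| ≤ 1 := by
  have hu : ∀ i, ((G.pureUtility k (Function.update a k i) : ℚ) : ℝ) =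
      ∑ l, (G.payoff k l i (a l) : ℝ) := by
    intro i
    rw [pureUtility_eq_sum, Rat.cast_sum]
    refine sum_congr rfl fun l _ => ?_
    by_cases h : l = k
    · subst h; simp [G.payoff_self]
    · rw [Function.update_of_ne h, Function.update_self]
  have h1 := hG k (Function.update a k i)
  have h2 := hG k (Function.update a k (o k))
  have h1' : (0 : ℝ) ≤ G.pureUtility k (Function.update a k i) ∧
      (G.pureUtility k (Function.update a k i) : ℝ) ≤ 1 := by exact_mod_cast h1
  have h2' : (0 : ℝ) ≤ G.pureUtility k (Function.update a k (o k)) ∧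
      (G.pureUtility k (Function.update a k (o k)) : ℝ) ≤ 1 := by exact_mod_cast h2
  simp only [advantage, sum_sub_distrib, ← hu]
  rw [abs_le]
  constructor <;> linarith [h1'.1, h1'.2, h2'.1, h2'.2]

theorem frequency_isStrategy (act : ℕ → G.JointAction) {T : ℕ} (hT : 0 < T) :
    G.IsStrategy (G.frequency act T) := by
  intro k
  refine ⟨fun i => by unfold frequency; positivity, ?_⟩
  have hT' : (T : ℝ) ≠ 0 := by positivity
  simp only [frequency]
  rw [← sum_div, div_eq_one_iff_eq hT', ← Nat.cast_sum, sum_comm]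
  simp

/-- Action payoffs are linear in the profile, so time averages may be taken inside. -/
theorem cumulated_eq (o : G.JointAction) (act : ℕ → G.JointAction) (T : ℕ)
    (k : Fin G.numPlayers) (i : Fin (G.numActions k)) :
    G.actionPayoff (G.frequency act T) k i - G.actionPayoff (G.frequency act T) k (o k) =
      G.cumulated o act T k i / T := by
  rw [← sum_advantage_mul, cumulated, sum_comm, sum_div]
  refine sum_congr rfl fun l _ => ?_
  simp only [frequency, mul_div_assoc', ← sum_div, Nat.cast_sum, mul_sum]
  rw [sum_comm]
  simp

/-- In the expansion of the square after one more round the cross term is at most zero by the greedy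
choice, and each squared increment is at most `1`. -/
theorem sum_sq_cumulated_le (hG : G.UnitPayoffs) {x : G.Profile} (hx : G.IsApproxNash 0 x)
    (hpos : ∀ k i, 0 < x k i) (o : G.JointAction) (act : ℕ → G.JointAction)
    (hact : ∀ t l j, ∑ k, ∑ i, G.cumulated o act t k i * G.advantage o k i l (act t l) ≤
      ∑ k, ∑ i, G.cumulated o act t k i * G.advantage o k i l j) (t : ℕ) :
    ∑ k, ∑ i, G.cumulated o act t k i ^ 2 ≤ t * ∑ k, (G.numActions k : ℝ) := by
  induction t with
  | zero => simp [cumulated]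
  | succ t ih =>
    have hstep : ∀ k i, G.cumulated o act (t + 1) k i =
        G.cumulated o act t k i + ∑ l, G.advantage o k i l (act t l) := fun k i =>
      sum_range_succ _ _
    have hsq : ∑ k, ∑ i, (∑ l, G.advantage o k i l (act t l)) ^ 2 ≤
        ∑ k, (G.numActions k : ℝ) := by
      refine sum_le_sum fun k _ => ?_
      refine (sum_le_card_nsmul _ _ 1 fun i _ => ?_).trans (by simp)
      rw [sq_le_one_iff_abs_le_one]
      exact abs_sum_advantage_le hG o (act t) k i
    have hcross : ∑ k, ∑ i, G.cumulated o act t k i * ∑ l, G.advantage o k i l (act t l) ≤ 0 := by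
      have hswap : ∀ f : (k : Fin G.numPlayers) → Fin (G.numActions k) → Fin G.numPlayers → ℝ,
          ∑ k, ∑ i, ∑ l, f k i l = ∑ l, ∑ k, ∑ i, f k i l := by
        intro f
        rw [sum_comm]
        exact sum_congr rfl fun k _ => sum_comm
      calc ∑ k, ∑ i, G.cumulated o act t k i * ∑ l, G.advantage o k i l (act t l)
          = ∑ l, ∑ k, ∑ i, G.cumulated o act t k i * G.advantage o k i l (act t l) := by
            simp only [mul_sum, hswap]
        -- The minimum over the actions of `l` is at most the average with the equilibrium weights
        -- `x l`.
        _ ≤ ∑ l, ∑ j, x l j * ∑ k, ∑ i, G.cumulated o act t k i * G.advantage o k i l j := by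
            refine sum_le_sum fun l _ => ?_
            calc _ = ∑ j, x l j *
                  ∑ k, ∑ i, G.cumulated o act t k i * G.advantage o k i l (act t l) := by
                  rw [← sum_mul, (hx.1 l).2, one_mul]
              _ ≤ _ := sum_le_sum fun j _ =>
                  mul_le_mul_of_nonneg_left (hact t l j) (hpos l j).le
        _ = ∑ l, ∑ k, ∑ i, ∑ j, G.cumulated o act t k i * (G.advantage o k i l j * x l j) := by
            refine sum_congr rfl fun l _ => ?_
            simp only [mul_sum]
            rw [sum_comm]
            refine sum_congr rfl fun k _ => ?_
            rw [sum_comm]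
            exact sum_congr rfl fun i _ => sum_congr rfl fun j _ => by ring
        _ = ∑ k, ∑ i, G.cumulated o act t k i * ∑ l, ∑ j, G.advantage o k i l j * x l j := by
            rw [← hswap]
            simp only [mul_sum]
        _ = 0 := by
            refine sum_eq_zero fun k _ => sum_eq_zero fun i _ => ?_
            rw [sum_advantage_mul, actionPayoff_eq_of_interior hx hpos k i (o k)]
            simp
    have hexp : ∑ k, ∑ i, G.cumulated o act (t + 1) k i ^ 2 =
        ∑ k, ∑ i, G.cumulated o act t k i ^ 2 +
        2 * ∑ k, ∑ i, G.cumulated o act t k i * ∑ l, G.advantage o k i l (act t l) +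
        ∑ k, ∑ i, (∑ l, G.advantage o k i l (act t l)) ^ 2 := by
      simp only [hstep, add_sq, sum_add_distrib]
      simp only [mul_sum (s := univ) (a := (2 : ℝ)), mul_assoc]
    rw [hexp]
    push_cast
    linarith

theorem frequency_isApproxNash (hG : G.UnitPayoffs) {x : G.Profile} (hx : G.IsApproxNash 0 x)
    (hpos : ∀ k i, 0 < x k i) (o : G.JointAction) (act : ℕ → G.JointAction)
    (hact : ∀ t l j, ∑ k, ∑ i, G.cumulated o act t k i * G.advantage o k i l (act t l) ≤
      ∑ k, ∑ i, G.cumulated o act t k i * G.advantage o k i l j) {T : ℕ} (hT : 0 < T) {ε : ℝ}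
    (hε : 0 < ε) (hTε : 4 * ∑ k, (G.numActions k : ℝ) ≤ T * ε ^ 2) :
    G.IsApproxNash ε (G.frequency act T) := by
  refine isApproxNash_of_abs_le (frequency_isStrategy act hT) o fun k i => ?_
  have hT' : (0 : ℝ) < T := by exact_mod_cast hT
  rw [cumulated_eq o act T, abs_div, abs_of_pos hT', div_le_iff₀ hT']
  refine abs_le_of_sq_le_sq ?_ (by positivity)
  have h1 : G.cumulated o act T k i ^ 2 ≤ ∑ k, ∑ i, G.cumulated o act T k i ^ 2 :=
    (single_le_sum (f := fun i => G.cumulated o act T k i ^ 2) (fun i _ => sq_nonneg _)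
      (mem_univ i)).trans (single_le_sum (f := fun k => ∑ i, G.cumulated o act T k i ^ 2)
        (fun k _ => sum_nonneg fun i _ => sq_nonneg _) (mem_univ k))
  have h2 := sum_sq_cumulated_le hG hx hpos o act hact T
  -- Together: the square is at most `T * M`, and `4 * T * M ≤ (T * ε) ^ 2`, with `M` the total
  -- number of actions.
  have h3 := mul_le_mul_of_nonneg_left hTε hT'.le
  nlinarith

end PolymatrixGame

/-! ### Positions in concatenated lists -/

theorem List.getD_flatMap_finRange {α : Type*} {n : ℕ} (f : Fin n → List α) (len : ℕ → ℕ)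
    (hlen : ∀ k, (f k).length = len k) (d : α) (k : Fin n) {r : ℕ} (hr : r < len k) :
    ((List.finRange n).flatMap f).getD (∑ k' ∈ Finset.range k, len k' + r) d =
      (f k).getD r d := by
  induction n generalizing len with
  | zero => exact k.elim0
  | succ n ih =>
    rw [List.finRange_succ, List.flatMap_cons, List.flatMap_map]
    induction k using Fin.cases with
    | zero => simpa using List.getD_append _ _ _ _ (by rw [hlen]; exact hr)
    | succ k =>
      rw [Fin.val_succ, Finset.sum_range_succ', List.getD_append_right _ _ _ _
        (by rw [hlen, Fin.val_zero]; omega), hlen, Fin.val_zero]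
      rw [show ∑ k' ∈ Finset.range (k : ℕ), len (k' + 1) + len 0 + r - len 0 =
        ∑ k' ∈ Finset.range (k : ℕ), len (k' + 1) + r by omega]
      exact ih (fun k => f k.succ) (fun k => len (k + 1)) (fun k => hlen k.succ) k hr

theorem List.length_flatMap_finRange {α : Type*} {n : ℕ} (f : Fin n → List α) :
    ((List.finRange n).flatMap f).length = ∑ k, (f k).length := by
  rw [List.length_flatMap, Fin.sum_univ_def]

theorem exists_eq_sum_range_add (len : ℕ → ℕ) {n r : ℕ} (h : r < ∑ k ∈ Finset.range n, len k) :
    ∃ k < n, ∃ r' < len k, r = ∑ k' ∈ Finset.range k, len k' + r' := by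
  induction n with
  | zero => simp at h
  | succ n ih =>
    rcases lt_or_ge r (∑ k ∈ Finset.range n, len k) with h' | h'
    · obtain ⟨k, hk, H⟩ := ih h'
      exact ⟨k, hk.trans (Nat.lt_succ_self n), H⟩
    · rw [Finset.sum_range_succ] at h
      exact ⟨n, Nat.lt_succ_self n, r - ∑ k ∈ Finset.range n, len k, by omega, by omega⟩

namespace PolymatrixGame

open Finset RAM Word

/-! ### Reading the input word -/

variable (G : PolymatrixGame) (ε : ℚ)

theorem length_encode : (G.encode ε).length =
    3 + G.numPlayers + ∑ k, ∑ l, G.numActions k * (G.numActions l * 2) := by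
  simp [encode, List.length_flatMap_finRange, -List.length_flatMap]
  omega

theorem encode_getD_zero : (G.encode ε).getD 0 0 = ε.num := by simp [encode]

theorem encode_getD_one : (G.encode ε).getD 1 0 = ε.den := by simp [encode]

/-- Already the diagonal block of player `k` contributes enough cells, as zero blocks are listed
too. -/
theorem numActions_le_sum (k : Fin G.numPlayers) :
    G.numActions k ≤ ∑ l, G.numActions k * (G.numActions l * 2) := by
  refine le_trans ?_ (single_le_sum (f := fun l => G.numActions k * (G.numActions l * 2))
    (fun _ _ => Nat.zero_le _) (mem_univ k))
  rcases Nat.eq_zero_or_pos (G.numActions k) with h | h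
  · simp [h]
  · exact Nat.le_mul_of_pos_right _ (by omega)

theorem sum_numActions_le_length : ∑ k, G.numActions k ≤ (G.encode ε).length := by
  rw [length_encode]
  exact (sum_le_sum fun k _ => G.numActions_le_sum k).trans (Nat.le_add_left _ _)

theorem players_encode : players (G.encode ε) = G.numPlayers := by
  have h : (G.encode ε).getD 2 0 = G.numPlayers := by simp [encode]
  have := G.length_encode ε
  rw [players, clip, h]
  omega

theorem actions_encode (k : Fin G.numPlayers) : actions (G.encode ε) k = G.numActions k := by
  have h : (G.encode ε).getD (3 + k) 0 = G.numActions k := by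
    rw [encode, List.append_assoc, List.getD_append_right _ _ _ _ (by simp),
      List.getD_append _ _ _ _ (by simp), List.getD_eq_getElem?_getD]
    simp
  have := (single_le_sum (f := G.numActions) (fun _ _ => Nat.zero_le _) (mem_univ k)).trans
    (G.sum_numActions_le_length ε)
  rw [actions, clip, h]
  omega

theorem encode_getD_entry (k l : Fin G.numPlayers) (i : Fin (G.numActions k))
    (j : Fin (G.numActions l)) {e : ℕ} (he : e < 2) :
    (G.encode ε).getD (3 + players (G.encode ε) + 2 * entryIndex (G.encode ε) k l i j + e) 0 =
      [(G.payoff k l i j).num, ((G.payoff k l i j).den : ℤ)].getD e 0 := by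
  set m := actions (G.encode ε) with hm
  have hm' : ∀ k : Fin G.numPlayers, G.numActions k = m k := fun k =>
    (G.actions_encode ε k).symm
  have hj : (j : ℕ) < m l := by rw [← hm']; exact j.2
  have hi : (i : ℕ) < m k := by rw [← hm']; exact i.2
  have hje : (j : ℕ) * 2 + e < m l * 2 := by omega
  have hie : (i : ℕ) * (m l * 2) + (j * 2 + e) < m k * (m l * 2) := mul_add_lt_mul hi hje
  have hle : ∑ l' ∈ range (l : ℕ), m k * (m l' * 2) + (i * (m l * 2) + (j * 2 + e)) <
      ∑ l' ∈ range G.numPlayers, m k * (m l' * 2) :=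
    calc _ < ∑ l' ∈ range ((l : ℕ) + 1), m k * (m l' * 2) := by rw [sum_range_succ]; omega
      _ ≤ _ := sum_le_sum_of_subset (range_subset_range.2 l.2)
  have hpos : 3 + players (G.encode ε) + 2 * entryIndex (G.encode ε) k l i j + e =
      3 + G.numPlayers + (∑ k' ∈ range (k : ℕ), ∑ l' ∈ range G.numPlayers, m k' * (m l' * 2) +
        (∑ l' ∈ range (l : ℕ), m k * (m l' * 2) + (i * (m l * 2) + (j * 2 + e)))) := by
    simp only [entryIndex, players_encode, ← hm, ← mul_assoc, ← sum_mul]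
    ring
  rw [hpos, encode, List.getD_append_right _ _ _ _ (by simp; omega)]
  rw [show ∀ x, 3 + G.numPlayers + x - ([ε.num, (ε.den : ℤ), (G.numPlayers : ℤ)] ++
    (List.finRange G.numPlayers).map (fun k => (G.numActions k : ℤ))).length = x by
      intro x; simp; omega]
  have hlen4 : ∀ k l i j, ([(G.payoff k l i j).num, ((G.payoff k l i j).den : ℤ)]).length = 2 :=
    fun _ _ _ _ => rfl
  rw [List.getD_flatMap_finRange _ (fun k => ∑ l' ∈ range G.numPlayers, m k * (m l' * 2)) ?_ _ k
      hle,
    List.getD_flatMap_finRange _ (fun l => m k * (m l * 2)) ?_ _ l hie]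
  · have h1 := List.getD_flatMap_finRange (fun i => (List.finRange (G.numActions l)).flatMap
      fun j => [(G.payoff k l i j).num, ((G.payoff k l i j).den : ℤ)]) (fun _ => m l * 2)
      (by simp [List.length_flatMap_finRange, -List.length_flatMap, hm']) 0 i hje
    have h2 := List.getD_flatMap_finRange (fun j => [(G.payoff k l i j).num,
      ((G.payoff k l i j).den : ℤ)]) (fun _ => 2) (fun _ => rfl) 0 j he
    simp only [sum_const, card_range, smul_eq_mul] at h1 h2
    rw [h1, h2]
  · intro l
    simp [List.length_flatMap_finRange, -List.length_flatMap, hm']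
  · intro k
    simp [List.length_flatMap_finRange, -List.length_flatMap, hm', sum_range]

theorem entryIndex_lt (k l : Fin G.numPlayers) (i : Fin (G.numActions k))
    (j : Fin (G.numActions l)) : entryIndex (G.encode ε) k l i j <
      entryIndex (G.encode ε) (players (G.encode ε)) 0 0 0 := by
  set m := actions (G.encode ε) with hm
  have hj : (j : ℕ) < m l := by rw [hm, actions_encode]; exact j.2
  have hi : (i : ℕ) < m k := by rw [hm, actions_encode]; exact i.2
  have hie : (i : ℕ) * m l + j < m k * m l := mul_add_lt_mul hi hj
  simp only [entryIndex, players_encode, ← hm, range_zero, sum_empty, zero_mul, add_zero]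
  have hle : ∑ l' ∈ range (l : ℕ), m k * m l' + (i * m l + j) <
      ∑ l' ∈ range G.numPlayers, m k * m l' :=
    calc _ < ∑ l' ∈ range ((l : ℕ) + 1), m k * m l' := by rw [sum_range_succ]; omega
      _ ≤ _ := sum_le_sum_of_subset (range_subset_range.2 l.2)
  calc _ < ∑ k' ∈ range ((k : ℕ) + 1), ∑ l' ∈ range G.numPlayers, m k' * m l' := by
        rw [sum_range_succ]; omega
    _ ≤ _ := sum_le_sum_of_subset (range_subset_range.2 k.2)

/-- Guarantees that `scale` multiplies nothing but denominators, so it does not vanish. -/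
theorem exists_entryIndex_eq {r : ℕ}
    (hr : r < entryIndex (G.encode ε) (players (G.encode ε)) 0 0 0) :
    ∃ (k l : Fin G.numPlayers) (i : Fin (G.numActions k)) (j : Fin (G.numActions l)),
      r = entryIndex (G.encode ε) k l i j := by
  simp only [entryIndex, players_encode, range_zero, sum_empty, zero_mul, add_zero] at hr ⊢
  obtain ⟨k, hk, r₁, hr₁, rfl⟩ := exists_eq_sum_range_add _ hr
  obtain ⟨l, hl, r₂, hr₂, rfl⟩ := exists_eq_sum_range_add _ hr₁
  have hml : 0 < actions (G.encode ε) l := Nat.pos_of_ne_zero fun h => by simp [h] at hr₂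
  refine ⟨⟨k, hk⟩, ⟨l, hl⟩, ⟨r₂ / actions (G.encode ε) l, ?_⟩,
    ⟨r₂ % actions (G.encode ε) l, ?_⟩, ?_⟩
  · rw [← G.actions_encode ε ⟨k, hk⟩]
    exact Nat.div_lt_of_lt_mul (by rwa [mul_comm])
  · rw [← G.actions_encode ε ⟨l, hl⟩]
    exact Nat.mod_lt _ hml
  · rw [Nat.div_add_mod']

theorem scale_ne_zero : scale (G.encode ε) ≠ 0 := by
  refine prod_ne_zero_iff.2 fun r hr => ?_
  obtain ⟨k, l, i, j, rfl⟩ := G.exists_entryIndex_eq ε (mem_range.1 hr)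
  rw [encode_getD_entry G ε k l i j one_lt_two]
  exact Int.natCast_ne_zero.2 (G.payoff k l i j).den_ne_zero

/-- The integer division in `entry` is exact, because each denominator is a factor of `scale`. -/
theorem entry_encode (k l : Fin G.numPlayers) (i : Fin (G.numActions k))
    (j : Fin (G.numActions l)) :
    (entry (G.encode ε) k l i j : ℝ) = scale (G.encode ε) * G.payoff k l i j := by
  have h0 := encode_getD_entry G ε k l i j two_pos
  have h1 : _ = ((G.payoff k l i j).den : ℤ) := encode_getD_entry G ε k l i j one_lt_two
  have hd : ((G.payoff k l i j).den : ℤ) ∣ scale (G.encode ε) := by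
    rw [← h1]
    exact dvd_prod_of_mem (fun r => (G.encode ε).getD (3 + players (G.encode ε) + 2 * r + 1) 0)
      (mem_range.2 (G.entryIndex_lt ε k l i j))
  have hden : ((G.payoff k l i j).den : ℝ) ≠ 0 :=
    Nat.cast_ne_zero.2 (G.payoff k l i j).den_ne_zero
  rw [add_zero] at h0
  rw [entry, h0, h1, Int.cast_mul, Int.cast_div hd (by simp)]
  conv_rhs => rw [Rat.cast_def]
  simp only [List.getD_cons_zero, Int.cast_natCast]
  ring

/-! ### The computed sequence of joint actions -/

variable {G}

/-- Every player uses its first action. -/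
def firstAction (hm : ∀ k, 0 < G.numActions k) : G.JointAction := fun k => ⟨0, hm k⟩

theorem play_eq_minIndex (t : ℕ) (l : Fin G.numPlayers) :
    play (G.encode ε) (t * G.numPlayers + l) =
      minIndex (score (G.encode ε) (play (G.encode ε)) t l) (G.numActions l) := by
  have hmod : (t * G.numPlayers + l) % G.numPlayers = l := by
    rw [Nat.mul_add_mod', Nat.mod_eq_of_lt l.2]
  have hdiv : (t * G.numPlayers + l) / G.numPlayers = t := by
    rw [Nat.mul_comm, Nat.mul_add_div l.pos, Nat.div_eq_of_lt l.2, add_zero]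
  rw [play_eq_reply, reply, players_encode, hmod, hdiv, actions_encode]

/-- The joint action chosen by the algorithm in round `t`. -/
def roundAction (hm : ∀ k, 0 < G.numActions k) (t : ℕ) : G.JointAction := fun l =>
  ⟨play (G.encode ε) (t * G.numPlayers + l), by
    rw [play_eq_minIndex]; exact minIndex_lt _ (hm l)⟩

theorem gap_encode (hm : ∀ k, 0 < G.numActions k) (k l : Fin G.numPlayers)
    (i : Fin (G.numActions k)) (j : Fin (G.numActions l)) :
    (gap (G.encode ε) k i l j : ℝ) =
      scale (G.encode ε) * G.advantage (firstAction hm) k i l j := by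
  have h := G.entry_encode ε k l (firstAction hm k) j
  rw [gap, Int.cast_sub, entry_encode, advantage, mul_sub, ← h]
  rfl

theorem drift_encode (hm : ∀ k, 0 < G.numActions k) (t : ℕ) (k : Fin G.numPlayers)
    (i : Fin (G.numActions k)) :
    (drift (G.encode ε) (play (G.encode ε)) t k i : ℝ) =
      scale (G.encode ε) * G.cumulated (firstAction hm) (roundAction ε hm) t k i := by
  simp only [drift, cumulated, players_encode, Int.cast_sum, mul_sum]
  refine sum_congr rfl fun t' _ => ?_
  rw [sum_range]
  exact sum_congr rfl fun l _ => gap_encode ε hm k l i (roundAction ε hm t' l)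

/-- Both factors of each product carry one `scale`. The square is positive, so minimizing the
integer score minimizes the real inner product. -/
theorem score_encode (hm : ∀ k, 0 < G.numActions k) (t : ℕ) (l : Fin G.numPlayers)
    (j : Fin (G.numActions l)) :
    (score (G.encode ε) (play (G.encode ε)) t l j : ℝ) = (scale (G.encode ε) : ℝ) ^ 2 *
      ∑ k, ∑ i, G.cumulated (firstAction hm) (roundAction ε hm) t k i *
        G.advantage (firstAction hm) k i l j := by
  simp only [score, players_encode, Int.cast_sum, Int.cast_mul, mul_sum]
  rw [sum_range]
  refine sum_congr rfl fun k _ => ?_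
  rw [actions_encode, sum_range]
  refine sum_congr rfl fun i _ => ?_
  rw [gap_encode ε hm, drift_encode ε hm]
  ring

theorem roundAction_le (hm : ∀ k, 0 < G.numActions k) (t : ℕ) (l : Fin G.numPlayers)
    (j : Fin (G.numActions l)) :
    ∑ k, ∑ i, G.cumulated (firstAction hm) (roundAction ε hm) t k i *
        G.advantage (firstAction hm) k i l (roundAction ε hm t l) ≤
      ∑ k, ∑ i, G.cumulated (firstAction hm) (roundAction ε hm) t k i *
        G.advantage (firstAction hm) k i l j := by
  have h := apply_minIndex_le (score (G.encode ε) (play (G.encode ε)) t l) j.2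
  rw [← play_eq_minIndex] at h
  have h' : (score (G.encode ε) (play (G.encode ε)) t l (roundAction ε hm t l) : ℝ) ≤
    score (G.encode ε) (play (G.encode ε)) t l j := by exact_mod_cast h
  rw [score_encode ε hm, score_encode ε hm] at h'
  have hQ : (scale (G.encode ε) : ℝ) ≠ 0 := Int.cast_ne_zero.2 (G.scale_ne_zero ε)
  exact le_of_mul_le_mul_left h' (by positivity)

theorem frequency_eq (hm : ∀ k, 0 < G.numActions k) (k : Fin G.numPlayers)
    (i : Fin (G.numActions k)) :
    G.frequency (roundAction ε hm) (rounds (G.encode ε)) k i =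
      ((count (G.encode ε) k i : ℤ) : ℝ) / ((rounds (G.encode ε) : ℤ) : ℝ) := by
  simp only [frequency, count, players_encode, Int.cast_natCast, roundAction, Fin.ext_iff]

/-! ### The number of rounds -/

variable {ε}

theorem rounds_eq : (rounds (G.encode ε) : ℤ) =
    4 * (G.encode ε).length * (ε.den * ε.den) / (ε.num * ε.num) + 1 := by
  rw [rounds, encode_getD_zero, encode_getD_one, Nat.cast_succ, Int.toNat_of_nonneg]
  exact Int.ediv_nonneg (by positivity) (mul_self_nonneg _)

theorem le_rounds_mul_sq (hε : 0 < ε) :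
    4 * ∑ k, (G.numActions k : ℝ) ≤ rounds (G.encode ε) * (ε : ℝ) ^ 2 := by
  have hnum : 0 < ε.num := Rat.num_pos.2 hε
  have h := Int.lt_ediv_add_one_mul_self (4 * (G.encode ε).length * (ε.den * ε.den : ℤ))
    (mul_pos hnum hnum)
  rw [← rounds_eq] at h
  have h' : (4 * (G.encode ε).length * (ε.den * ε.den) : ℝ) <
    rounds (G.encode ε) * (ε.num * ε.num) := by exact_mod_cast h
  have hden : (0 : ℝ) < ε.den := by exact_mod_cast ε.den_pos
  have hL : (∑ k, (G.numActions k : ℝ)) ≤ (G.encode ε).length := by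
    exact_mod_cast G.sum_numActions_le_length ε
  rw [Rat.cast_def, div_pow, mul_div_assoc', le_div_iff₀ (by positivity)]
  nlinarith [mul_le_mul_of_nonneg_right hL (mul_pos hden hden).le]

theorem rounds_le (hε : 0 < ε) :
    rounds (G.encode ε) ≤ (wordSize (G.encode ε) + ⌈1 / ε⌉₊ + 2) ^ 5 := by
  have hnum : 0 < ε.num := Rat.num_pos.2 hε
  -- This is `1 / ε ≤ ⌈1 / ε⌉₊` with denominators cleared; it replaces `1 / ε ^ 2` by `E * E` below.
  have hE : (ε.den : ℤ) ≤ ⌈1 / ε⌉₊ * ε.num := by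
    have h := Nat.le_ceil (1 / ε)
    have hn : (0 : ℚ) < ε.num := by exact_mod_cast hnum
    nth_rw 1 [← Rat.num_div_den ε] at h
    rw [one_div_div, div_le_iff₀ hn] at h
    exact_mod_cast h
  set E := ⌈1 / ε⌉₊
  set s := wordSize (G.encode ε)
  have hL : (G.encode ε).length ≤ s := length_le_wordSize _
  have h1 : 4 * (G.encode ε).length * (ε.den * ε.den : ℤ) / (ε.num * ε.num) ≤
      4 * s * (E * E) := by
    refine Int.ediv_le_of_le_mul (mul_pos hnum hnum) ?_
    calc 4 * (G.encode ε).length * (ε.den * ε.den : ℤ)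
        ≤ 4 * s * ((E * ε.num) * (E * ε.num)) := by gcongr
      _ = 4 * s * (E * E) * (ε.num * ε.num) := by ring
  have h2 : rounds (G.encode ε) ≤ 4 * s * (E * E) + 1 := by
    have := rounds_eq (G := G) (ε := ε)
    zify
    omega
  calc rounds (G.encode ε) ≤ 4 * s * (E * E) + 1 := h2
    _ ≤ 4 * (s + E) * ((s + E) * (s + E)) + 1 := by gcongr <;> omega
    _ ≤ (s + E + 2) ^ 5 := by
      generalize s + E = x
      ring_nf
      omega

/-! ### Writing the output word -/

variable (ε)

theorem offset_add_lt (w : List ℤ) {k k' i : ℕ} (h : k < k') (hi : i < actions w k) :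
    offset w k + i < offset w k' :=
  calc offset w k + i < offset w (k + 1) := by rw [offset, offset, sum_range_succ]; omega
    _ ≤ offset w k' := sum_le_sum_of_subset (range_subset_range.2 h)

/-- Different actions own different output slots, so a single term of `output` survives. -/
theorem offset_add_inj (w : List ℤ) {k k' i i' : ℕ} (hi : i < actions w k)
    (hi' : i' < actions w k') (h : offset w k + i = offset w k' + i') : k = k' ∧ i = i' := by
  rcases lt_trichotomy k k' with hk | rfl | hk
  · have := offset_add_lt w hk hi; omega
  · exact ⟨rfl, by omega⟩
  · have := offset_add_lt w hk hi'; omega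

theorem output_eq (w : List ℤ) {k i e : ℕ} (hk : k < players w) (hi : i < actions w k)
    (he : e < 2) : output w (2 * (offset w k + i) + e) = if e = 0 then count w k i else rounds w := by
  rw [output, sum_eq_single k, sum_eq_single i]
  · interval_cases e <;> simp
  · intro i' _ hne
    rw [if_neg (by omega), if_neg (by omega)]
  · simp [hi]
  · intro k' _ hne
    refine sum_eq_zero fun i' hi' => ?_
    rw [mem_range] at hi'
    have hne' : offset w k + i ≠ offset w k' + i' :=
      fun h => hne (offset_add_inj w hi hi' h).1.symm
    rw [if_neg (by omega), if_neg (by omega)]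
  · simp [hk]

variable (G) in
/-- The empirical frequencies of the computed actions as a word. -/
def result : List ℤ :=
  (List.finRange G.numPlayers).flatMap fun k =>
    (List.finRange (G.numActions k)).flatMap fun i : Fin (G.numActions k) =>
      [(count (G.encode ε) k i : ℤ), (rounds (G.encode ε) : ℤ)]

theorem length_result :
    (G.result ε).length = 2 * offset (G.encode ε) (players (G.encode ε)) := by
  simp only [result, List.length_flatMap_finRange, offset, players_encode, sum_range,
    actions_encode, mul_sum]
  simp [mul_comm]

theorem output_eq_getElem {r : ℕ} (hr : r < (G.result ε).length) :
    (output (G.encode ε) r : ℤ) = (G.result ε)[r] := by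
  set w := G.encode ε with hw
  have hr' : r < ∑ k ∈ range G.numPlayers, actions w k * 2 := by
    rw [length_result, offset, players_encode, ← hw, mul_sum] at hr
    simpa only [mul_comm] using hr
  obtain ⟨k, hk, r₁, hr₁, hr₂⟩ := exists_eq_sum_range_add _ hr'
  have hi : r₁ / 2 < actions w k := by omega
  have hi' : r₁ / 2 < G.numActions ⟨k, hk⟩ := by rwa [← G.actions_encode ε ⟨k, hk⟩]
  have he : r₁ % 2 < 2 := Nat.mod_lt _ two_pos
  have hpos : r = 2 * (offset w k + r₁ / 2) + r₁ % 2 := by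
    rw [hr₂, offset, ← sum_mul]
    omega
  have h1 := List.getD_flatMap_finRange (fun k =>
    (List.finRange (G.numActions k)).flatMap fun i : Fin (G.numActions k) =>
      [(count w k i : ℤ), (rounds w : ℤ)]) (fun k => actions w k * 2)
    (by simp [List.length_flatMap_finRange, -List.length_flatMap, hw, actions_encode]) 0
    ⟨k, hk⟩ hr₁
  have h2 := List.getD_flatMap_finRange (fun i : Fin (G.numActions ⟨k, hk⟩) =>
    [(count w k i : ℤ), (rounds w : ℤ)]) (fun _ => 2) (fun _ => rfl) 0 ⟨r₁ / 2, hi'⟩ he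
  simp only [sum_const, card_range, smul_eq_mul, Nat.div_add_mod'] at h2
  rw [← List.getD_eq_getElem (d := 0)]
  refine Eq.trans ?_ ((congrArg (fun r => (G.result ε).getD r 0) hr₂).trans
    (h1.trans h2)).symm
  rw [hpos, output_eq w (by rw [players_encode]; exact hk) hi he]
  interval_cases r₁ % 2 <;> rfl

end PolymatrixGame

theorem mainTheorem12 :
    PolymatrixGame.AdmitsNashFPTAS {G : PolymatrixGame | G.UnitPayoffs ∧ G.HasInteriorNash} := by
  -- All admissible instances form one ghost parameter type, so the program and the exponent come
  -- out uniform.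
  let Γ : Type := {p : PolymatrixGame × ℚ // (p.1.UnitPayoffs ∧ p.1.HasInteriorNash) ∧ 0 < p.2}
  obtain ⟨c, k, hc⟩ := PolymatrixGame.exists_program (Γ := Γ) (fun γ => γ.1.1.encode γ.1.2)
    (fun γ => RAM.wordSize (γ.1.1.encode γ.1.2) + ⌈1 / γ.1.2⌉₊) (fun γ => Nat.le_add_right _ _)
    ⟨5, fun γ => PolymatrixGame.rounds_le γ.2.2⟩
  refine ⟨c, (Polynomial.X + Polynomial.C 2) ^ k, fun G hG ε hε => ?_⟩
  obtain ⟨s, t, hx, ht, hlen, hout⟩ := hc ⟨(G, ε), hG, hε⟩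
  obtain ⟨hunit, x, hx0, hpos⟩ := hG
  have hm := PolymatrixGame.numActions_pos hx0.1
  refine ⟨G.result ε, t, G.frequency (PolymatrixGame.roundAction ε hm)
    (PolymatrixGame.Word.rounds (G.encode ε)), ⟨s, hx, ?_, fun i hi => ?_⟩, by simpa using ht,
    ⟨fun k i => PolymatrixGame.Word.count (G.encode ε) k i,
      fun _ _ => PolymatrixGame.Word.rounds (G.encode ε),
      fun k i => ⟨Int.natCast_pos.2 (Nat.succ_pos _), PolymatrixGame.frequency_eq ε hm k i⟩, rfl⟩,
    PolymatrixGame.frequency_isApproxNash hunit hx0 hpos (PolymatrixGame.firstAction hm) _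
      (PolymatrixGame.roundAction_le ε hm) (Nat.succ_pos _) (by exact_mod_cast hε)
      (PolymatrixGame.le_rounds_mul_sq hε)⟩
  · rw [PolymatrixGame.length_result]; exact hlen
  · rw [← PolymatrixGame.output_eq_getElem]
    exact hout i (by rwa [PolymatrixGame.length_result] at hi)
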